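/- Let $d,l>0$, $u,C_0\in\mathbb C$, and $W\in L_2(0,2l)$ (complex-valued). Suppose that $\Delta$ is a function of $\lambda=\rho^2$ with the representation $$\Delta(\lambda)=\frac{d^2\rho}{2}\sin 2\rho l-d\cos 2\rho l+d^2u\,\frac{\sin\rho l}{\rho}+C_0\,\frac{\sin 2\rho l}{\rho}+\int_0^{2l}W(t)\,\frac{\sin\rho t}{2\rho}\,dt .$$ Let $c_2(\rho^2)=d\cos\rho l+\frac{1-d^2\rho^2}{\rho}\sin\rho l$, and for each $n\ge1$ let $z_n$ be any zero of the function $z\mapsto c_2(z^2)$ in the interval $\left(\frac{\pi n}{l}-\frac{\pi}{2l},\frac{\pi n}{l}+\frac{\pi}{2l}\right)$. Put $c=-2(C_0+1)/d^2$. Suppose that for all $n\in\mathbb N$, $n\ge 1$, $$\Delta\Big(\Big(\frac{\pi n}{l}\Big)^2\Big)=-d+d\Big(\frac{l}{\pi n}\Big)^2\big[c-(-1)^nu+\kappa_n\big],\qquad \Delta(z_n^2)=\frac{\sin z_nl}{z_n^3}\big[h_2-(-1)^nh_1+\eta_n\big]$$ with some $h_1,h_2\in\mathbb C$ and some sequences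 $\{\kappa_n\}_{n\ge1},\{\eta_n\}_{n\ge1}\in l_2$. Then there exist functions $g\in W^1_2[0,l]$ with $g(0)=u$ and $g(l)=c$, and $G_2\in W^2_2[0,l]$, such that, with $G_1(x)=\int_x^l g(t)\,dt$, for almost all $t$, $$W(t)=\begin{cases} d\,g(l-t)-d\,g(l)-G_1(l-t)+d^2g'(l-t)-G_2(t), & t\in[0,l),\\ -d\,g(t-l)-d\,g(l)-G_1(t-l)+d^2g'(t-l)-G_2(2l-t), & t\in[l,2l],\end{cases}$$ and $g(t)=\frac1{2d}\{W(l-t)-W(l+t)\}$ for almost all $t\in[0,l]$. -/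

import Mathlib

open MeasureTheory Set

noncomputable section

namespace FrozenArg

/-- The value `c₂(z²)` for real `z ≠ 0`, where
`c₂(ρ²) = d cos ρl + (1 - d²ρ²) (sin ρl) / ρ`. -/
def c₂ (d l z : ℝ) : ℝ :=
  d * Real.cos (z * l) + (1 - d ^ 2 * z ^ 2) / z * Real.sin (z * l)

/-- `z 1, z 2, …` is a selection of positive zeros of `z ↦ c₂(z²)`, one zero from each interval
`(πn/l - π/(2l), πn/l + π/(2l))`. The value `z 0` plays no role. -/
def IsZeroSelection (d l : ℝ) (z : ℕ → ℝ) : Prop :=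
  ∀ n : ℕ, 1 ≤ n →
    z n ∈ Ioo (Real.pi * n / l - Real.pi / (2 * l)) (Real.pi * n / l + Real.pi / (2 * l)) ∧
    c₂ d l (z n) = 0

/-- `Δ` has the representation
`Δ(λ) = (d²ρ/2) sin 2ρl - d cos 2ρl + d²u (sin ρl)/ρ + C₀ (sin 2ρl)/ρ
  + ∫₀^{2l} W(t) (sin ρt)/(2ρ) dt`, where `λ = ρ²`.
The right-hand side is even in `ρ`; at `λ = 0` it is to be read as a limit, and nothing is
required of `Δ 0`. -/
def HasRepresentation (d l : ℝ) (u C₀ : ℂ) (W : ℝ → ℂ) (Δ : ℂ → ℂ) : Prop :=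
  ∀ ρ : ℂ, ρ ≠ 0 →
    Δ (ρ ^ 2) =
      ((d : ℂ) ^ 2 * ρ / 2 * Complex.sin (2 * ρ * l) - d * Complex.cos (2 * ρ * l)
        + (d : ℂ) ^ 2 * u * (Complex.sin (ρ * l) / ρ))
      + C₀ * (Complex.sin (2 * ρ * l) / ρ)
      + ∫ t in (0 : ℝ)..(2 * l), W t * (Complex.sin (ρ * t) / (2 * ρ))

/-- `f` belongs to the Sobolev space `W¹₂[0, l]` and `f'` is (a version of) its derivative:
`f` is absolutely continuous on `[0, l]`, being an antiderivative of the function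
`f' ∈ L₂(0, l)`. -/
def IsW12WithDeriv (l : ℝ) (f f' : ℝ → ℂ) : Prop :=
  MemLp f' 2 (volume.restrict (Ioo 0 l)) ∧
    ∀ x ∈ Icc 0 l, f x = f 0 + ∫ t in (0 : ℝ)..x, f' t

/-- `f` belongs to the Sobolev space `W²₂[0, l]`: it has a derivative `f'` on `[0, l]` which itself
belongs to `W¹₂[0, l]`. -/
def MemW22 (l : ℝ) (f : ℝ → ℂ) : Prop :=
  ∃ f' f'' : ℝ → ℂ, IsW12WithDeriv l f f' ∧ IsW12WithDeriv l f' f''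

/-- `G₁(x) = ∫ₓˡ g(t) dt`. -/
def G₁ (l : ℝ) (g : ℝ → ℂ) (x : ℝ) : ℂ := ∫ t in x..l, g t

/-- The structured form of `W ∈ L₂(0, 2l)` in terms of `g`, its derivative `g'`, and `G₂`
(equality almost everywhere, as elements of `L₂`). -/
def HasStructuredForm (d l : ℝ) (W g g' G₂ : ℝ → ℂ) : Prop :=
  (∀ᵐ t : ℝ, t ∈ Ico 0 l →
    W t = d * g (l - t) - d * g l - G₁ l g (l - t) + (d : ℂ) ^ 2 * g' (l - t) - G₂ t) ∧
  (∀ᵐ t : ℝ, t ∈ Icc l (2 * l) →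
    W t = -d * g (t - l) - d * g l - G₁ l g (t - l) + (d : ℂ) ^ 2 * g' (t - l) - G₂ (2 * l - t))

end FrozenArg

end

/-!
The two sequences of data determine, respectively, the odd and the even part of `W` with respect to
the midpoint of `(0, 2l)`. Write `ν = πn/l`, and let `cosT l f z` and `sinT l f z` be the cosine and
sine transforms of `f` over `(0, l)`. Folding the integral gives
`∫₀²ˡ W(t) sin zt dt = sin zl · cosT P - cos zl · sinT M` with `P(x) = W(l - x) + W(l + x)` and
`M(x) = W(l - x) - W(l + x)`.

At `z = ν` only `M` survives, and the first condition says that the sine coefficients of `M / (2d)`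
are `ν⁻¹ (u - (-1)ⁿ c + ℓ²)`. These are the sine coefficients of a `W¹₂` function `g` with `g 0 = u`
and `g l = c`: `g'` is built from its cosine coefficients by the Riesz–Fischer theorem, and
completeness of the sine system identifies `M / (2d)` with `g` (`exists_W12_of_sinT`, `exists_g`).

The prescribed form of `W` now forces `G₂(l - x)` to be the `L₂` function `reflectedG₂`, and the
point is that it lies in `W²₂`. At a zero `z` of `c₂(z²)` all terms of `Δ` containing the sine
transform of `g` cancel (`Δ_eq_of_zero`), and the second condition becomes
`z² · cosT (reflectedG₂) = a + (-1)ⁿ b + ℓ²`, because `z sin zl = (-1)ⁿ/d + ℓ²`. No basis property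
of the functions `cos zₙx` is needed: as `zₙ - ν = O(1/n)`, replacing `zₙ` by `ν` in a transform of
an `L₂` function costs an error of `n⁻¹ ℓ²`. The cosine coefficients at `ν` are therefore
`n⁻¹ ℓ²`, which gives `W¹₂` (`exists_W12_of_cosT`); after one integration by parts the sine
transform of the derivative has the asymptotics to which `exists_W12_of_sinT` applies, and this
gives `W²₂` (`exists_W22_of_cosT`).
-/

noncomputable section

namespace FrozenArg

open Filter Asymptotics

/-! ### Square-summable sequences -/

theorem memℓp_two_iff {ι : Type*} {a : ι → ℂ} : Memℓp a 2 ↔ Summable fun i => ‖a i‖ ^ 2 := by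
  rw [memℓp_gen_iff (by norm_num)]
  simp

/-- Square summability depends only on the order of magnitude at infinity; in particular finitely
many terms are irrelevant. -/
theorem memℓp_two_of_isBigO {a b : ℕ → ℂ} (hb : Memℓp b 2) (h : a =O[atTop] b) :
    Memℓp a 2 := by
  rw [memℓp_two_iff] at hb ⊢
  refine summable_of_isBigO_nat hb ?_
  have := (h.norm_left.norm_right).pow 2
  exact this

theorem memℓp_two_inv : Memℓp (fun n : ℕ => (n : ℂ)⁻¹) 2 := by
  rw [memℓp_two_iff]
  have := (Real.summable_nat_pow_inv (p := 2)).2 (by norm_num)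
  refine this.congr fun n => ?_
  simp

/-- A bounded multiple of a square-summable sequence is square summable. -/
theorem memℓp_two_bdd_mul {a b : ℕ → ℂ} (hb : Memℓp b 2)
    (ha : a =O[atTop] fun _ => (1 : ℂ)) : Memℓp (fun n => a n * b n) 2 :=
  memℓp_two_of_isBigO hb (by simpa using ha.mul (isBigO_refl b atTop))

/-! ### Sine and cosine coefficients on `(0, l)` -/

/-- The finite cosine transform `z ↦ ∫₀ˡ f(x) cos zx dx`. -/
def cosT (l : ℝ) (f : ℝ → ℂ) (z : ℝ) : ℂ := ∫ x in (0 : ℝ)..l, f x * (Real.cos (z * x) : ℂ)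

/-- The finite sine transform `z ↦ ∫₀ˡ f(x) sin zx dx`. -/
def sinT (l : ℝ) (f : ℝ → ℂ) (z : ℝ) : ℂ := ∫ x in (0 : ℝ)..l, f x * (Real.sin (z * x) : ℂ)

theorem intervalIntegrable_of_memLp {l : ℝ} (hl : 0 ≤ l) {f : ℝ → ℂ}
    (hf : MemLp f 2 (volume.restrict (Ioo 0 l))) : IntervalIntegrable f volume 0 l := by
  rw [intervalIntegrable_iff_integrableOn_Ioo_of_le hl]
  exact hf.integrable (by norm_num)

theorem intervalIntegrable_mul_cos {l : ℝ} {f : ℝ → ℂ}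
    (hf : IntervalIntegrable f volume 0 l) (z : ℝ) :
    IntervalIntegrable (fun x => f x * (Real.cos (z * x) : ℂ)) volume 0 l :=
  hf.mul_continuousOn (by fun_prop)

theorem intervalIntegrable_mul_sin {l : ℝ} {f : ℝ → ℂ}
    (hf : IntervalIntegrable f volume 0 l) (z : ℝ) :
    IntervalIntegrable (fun x => f x * (Real.sin (z * x) : ℂ)) volume 0 l :=
  hf.mul_continuousOn (by fun_prop)

theorem fourierCoeffOn_symm {l : ℝ} (h : -l < l) (f : ℝ → ℂ) (n : ℤ) :
    fourierCoeffOn h f n = (1 / (2 * l) : ℂ) *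
      ∫ x in (-l)..l, f x * ((Real.cos (Real.pi * n / l * x) : ℂ)
        - Complex.I * (Real.sin (Real.pi * n / l * x) : ℂ)) := by
  have hl : 0 < l := by linarith
  have hl' : (l : ℂ) ≠ 0 := by exact_mod_cast hl.ne'
  rw [fourierCoeffOn_eq_integral, Complex.real_smul]
  congr 1
  · push_cast; ring
  · refine intervalIntegral.integral_congr fun x _ => ?_
    simp only [fourier_coe_apply, smul_eq_mul]
    rw [mul_comm]
    congr 1
    have : 2 * (Real.pi : ℂ) * Complex.I * ((-n : ℤ) : ℂ) * x / ((l - -l : ℝ) : ℂ)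
        = ((-(Real.pi * n / l * x) : ℝ) : ℂ) * Complex.I := by
      push_cast
      field_simp
      ring
    rw [this, Complex.exp_mul_I, ← Complex.ofReal_cos, ← Complex.ofReal_sin]
    rw [Real.cos_neg, Real.sin_neg]
    push_cast
    ring

/-- The extension of a function from `(0, l)` to `(-l, l)` that is even for `s = 1` and odd for
`s = -1`. -/
def parityExt (l : ℝ) (s : ℂ) (f : ℝ → ℂ) (x : ℝ) : ℂ :=
  (Ioo 0 l).indicator f x + s * (Ioo 0 l).indicator f (-x)

theorem memLp_parityExt {l : ℝ} (s : ℂ) {f : ℝ → ℂ}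
    (hf : MemLp f 2 (volume.restrict (Ioo 0 l))) : MemLp (parityExt l s f) 2 volume := by
  have h1 : MemLp ((Ioo 0 l).indicator f) 2 volume :=
    (memLp_indicator_iff_restrict measurableSet_Ioo).2 hf
  have h2 : MemLp (fun x => (Ioo 0 l).indicator f (-x)) 2 volume :=
    h1.comp_measurePreserving (Measure.measurePreserving_neg volume)
  exact h1.add (h2.const_mul s)

theorem integral_indicator_symm {l : ℝ} (hl : 0 < l) (f φ : ℝ → ℂ) :
    ∫ x in (-l)..l, (Ioo 0 l).indicator f x * φ x = ∫ x in (0 : ℝ)..l, f x * φ x := by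
  rw [intervalIntegral.integral_of_le (by linarith), intervalIntegral.integral_of_le hl.le,
    integral_Ioc_eq_integral_Ioo, integral_Ioc_eq_integral_Ioo]
  have : ∀ x, (Ioo 0 l).indicator f x * φ x = (Ioo 0 l).indicator (fun x => f x * φ x) x := by
    intro x
    by_cases hx : x ∈ Ioo 0 l <;> simp [hx]
  simp_rw [this]
  rw [setIntegral_indicator measurableSet_Ioo]
  congr 2
  exact inter_eq_right.2 (Ioo_subset_Ioo_left (by linarith))

/-- The Fourier coefficients on `(-l, l)` of the even (`s = 1`) and odd (`s = -1`) extensions are the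
cosine and sine coefficients on `(0, l)`; this reduces the sine and cosine systems to the
exponential one. -/
theorem fourierCoeffOn_parityExt {l : ℝ} (hl : 0 < l) (h : -l < l) (s : ℂ) {f : ℝ → ℂ}
    (hf : MemLp f 2 (volume.restrict (Ioo 0 l))) (n : ℤ) :
    fourierCoeffOn h (parityExt l s f) n = (1 / (2 * l) : ℂ) *
      ((1 + s) * cosT l f (Real.pi * n / l) - Complex.I * (1 - s) * sinT l f (Real.pi * n / l)) := by
  rw [fourierCoeffOn_symm]
  congr 1
  set φ : ℝ → ℂ := fun x => (Real.cos (Real.pi * n / l * x) : ℂ)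
        - Complex.I * (Real.sin (Real.pi * n / l * x) : ℂ) with hφ
  set F := (Ioo 0 l).indicator f with hF
  have h1 : MemLp F 2 volume := (memLp_indicator_iff_restrict measurableSet_Ioo).2 hf
  have h2 : MemLp (fun x => F (-x)) 2 volume :=
    h1.comp_measurePreserving (Measure.measurePreserving_neg volume)
  have i1 : IntervalIntegrable F volume (-l) l := by
    rw [intervalIntegrable_iff_integrableOn_Ioc_of_le h.le]
    exact (h1.restrict _).integrable (by norm_num)
  have i2 : IntervalIntegrable (fun x => F (-x)) volume (-l) l := by
    rw [intervalIntegrable_iff_integrableOn_Ioc_of_le h.le]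
    exact (h2.restrict _).integrable (by norm_num)
  have hφc : Continuous φ := by fun_prop
  have e0 : ∫ x in (-l)..l, parityExt l s f x * φ x
      = (∫ x in (-l)..l, F x * φ x) + s * ∫ x in (-l)..l, F (-x) * φ x := by
    rw [← intervalIntegral.integral_const_mul, ← intervalIntegral.integral_add
      (i1.mul_continuousOn hφc.continuousOn) ((i2.mul_continuousOn hφc.continuousOn).const_mul s)]
    refine intervalIntegral.integral_congr fun x _ => ?_
    simp only [parityExt, ← hF]
    ring
  have e1 : ∫ x in (-l)..l, F (-x) * φ x = ∫ x in (-l)..l, F x * φ (-x) := by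
    have := intervalIntegral.integral_comp_neg (a := -l) (b := l) (fun x => F x * φ (-x))
    simpa using this
  have hfi := intervalIntegrable_of_memLp hl.le hf
  have ic := intervalIntegrable_mul_cos hfi (Real.pi * n / l)
  have is := intervalIntegrable_mul_sin hfi (Real.pi * n / l)
  have e2 : ∫ x in (0 : ℝ)..l, f x * φ x
      = cosT l f (Real.pi * n / l) - Complex.I * sinT l f (Real.pi * n / l) := by
    rw [cosT, sinT, ← intervalIntegral.integral_const_mul,
      ← intervalIntegral.integral_sub ic (is.const_mul _)]
    refine intervalIntegral.integral_congr fun x _ => ?_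
    simp only [hφ]
    ring
  have e3 : ∫ x in (0 : ℝ)..l, f x * φ (-x)
      = cosT l f (Real.pi * n / l) + Complex.I * sinT l f (Real.pi * n / l) := by
    rw [cosT, sinT, ← intervalIntegral.integral_const_mul,
      ← intervalIntegral.integral_add ic (is.const_mul _)]
    refine intervalIntegral.integral_congr fun x _ => ?_
    simp only [hφ, mul_neg, Real.cos_neg, Real.sin_neg]
    push_cast
    ring
  rw [e0, e1, hF, integral_indicator_symm hl, integral_indicator_symm hl f (fun x => φ (-x)), e2, e3]
  ring

theorem summable_fourierCoeffOn_parityExt {l : ℝ} (h : -l < l) (s : ℂ) {f : ℝ → ℂ}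
    (hf : MemLp f 2 (volume.restrict (Ioo 0 l))) :
    Summable fun n : ℕ => ‖fourierCoeffOn h (parityExt l s f) n‖ ^ 2 :=
  (hasSum_sq_fourierCoeffOn h ((memLp_parityExt s hf).restrict _)).summable.comp_injective
    Nat.cast_injective

/-- Cosine coefficients of an `L₂` function are square summable (Bessel's inequality). -/
theorem memℓp_cosT {l : ℝ} (hl : 0 < l) {f : ℝ → ℂ}
    (hf : MemLp f 2 (volume.restrict (Ioo 0 l))) :
    Memℓp (fun n : ℕ => cosT l f (Real.pi * n / l)) 2 := by
  have h : -l < l := by linarith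
  have hl' : (l : ℂ) ≠ 0 := by exact_mod_cast hl.ne'
  have := (memℓp_two_iff.2 (summable_fourierCoeffOn_parityExt h 1 hf)).const_smul (l : ℂ)
  convert this using 1
  ext n
  simp only [Pi.smul_apply, fourierCoeffOn_parityExt hl h 1 hf, smul_eq_mul, Int.cast_natCast]
  field_simp
  ring

/-- Sine coefficients of an `L₂` function are square summable (Bessel's inequality). -/
theorem memℓp_sinT {l : ℝ} (hl : 0 < l) {f : ℝ → ℂ}
    (hf : MemLp f 2 (volume.restrict (Ioo 0 l))) :
    Memℓp (fun n : ℕ => sinT l f (Real.pi * n / l)) 2 := by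
  have h : -l < l := by linarith
  have hl' : (l : ℂ) ≠ 0 := by exact_mod_cast hl.ne'
  have := (memℓp_two_iff.2 (summable_fourierCoeffOn_parityExt h (-1) hf)).const_smul
    (Complex.I * l : ℂ)
  convert this using 1
  ext n
  simp only [Pi.smul_apply, fourierCoeffOn_parityExt hl h (-1) hf, smul_eq_mul, Int.cast_natCast]
  field_simp
  linear_combination (2 * sinT l f (Real.pi * n / l)) * Complex.I_sq

theorem ae_eq_zero_of_fourierCoeffOn_parityExt {l : ℝ} (h : -l < l) (s : ℂ) {f : ℝ → ℂ}
    (hf : MemLp f 2 (volume.restrict (Ioo 0 l)))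
    (h0 : ∀ n : ℤ, fourierCoeffOn h (parityExt l s f) n = 0) :
    ∀ᵐ x : ℝ, x ∈ Ioo 0 l → f x = 0 := by
  have hE := (memLp_parityExt s hf).restrict (Ioc (-l) l)
  have key := (hasSum_sq_fourierCoeffOn h hE).tsum_eq
  simp only [h0, norm_zero, ne_eq, OfNat.ofNat_ne_zero, not_false_eq_true, zero_pow,
    tsum_zero] at key
  have hpos : (l - -l)⁻¹ ≠ 0 := inv_ne_zero (by linarith)
  have k2 := ((smul_eq_zero.1 key.symm).resolve_left hpos)
  rw [intervalIntegral.integral_of_le h.le] at k2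
  rw [integral_eq_zero_iff_of_nonneg (fun x => by positivity)
    ((memLp_two_iff_integrable_sq_norm hE.1).1 hE)] at k2
  have k3 := (ae_restrict_iff' measurableSet_Ioc).1 k2
  filter_upwards [k3] with x hx hx0
  have := hx ⟨by linarith [hx0.1], hx0.2.le⟩
  have hn : -x ∉ Ioo 0 l := fun hh => by linarith [hh.1, hx0.1]
  simpa [parityExt, hx0, hn] using this

/-- Completeness of the sine system `sin(πnx/l)`, `n ≥ 1`, in `L₂(0, l)`. -/
theorem ae_eq_zero_of_sinT {l : ℝ} (hl : 0 < l) {f : ℝ → ℂ}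
    (hf : MemLp f 2 (volume.restrict (Ioo 0 l)))
    (h0 : ∀ n : ℕ, 1 ≤ n → sinT l f (Real.pi * n / l) = 0) :
    ∀ᵐ x : ℝ, x ∈ Ioo 0 l → f x = 0 := by
  have h : -l < l := by linarith
  refine ae_eq_zero_of_fourierCoeffOn_parityExt h (-1) hf fun n => ?_
  have hn : ∀ n : ℕ, sinT l f (Real.pi * n / l) = 0 := by
    intro n
    rcases Nat.eq_zero_or_pos n with rfl | hn
    · simp [sinT]
    · exact h0 n hn
  have hz : sinT l f (Real.pi * n / l) = 0 := by
    rcases Int.eq_nat_or_neg n with ⟨m, rfl | rfl⟩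
    · exact_mod_cast hn m
    · have : sinT l f (Real.pi * (-(m : ℤ) : ℤ) / l) = - sinT l f (Real.pi * m / l) := by
        rw [sinT, sinT, ← intervalIntegral.integral_neg]
        refine intervalIntegral.integral_congr fun x _ => ?_
        rw [← mul_neg, ← Complex.ofReal_neg, ← Real.sin_neg]
        congr 3
        push_cast
        ring
      rw [this, hn, neg_zero]
  rw [fourierCoeffOn_parityExt hl h (-1) hf, hz]
  ring

/-- Completeness of the cosine system `cos(πnx/l)`, `n ≥ 0`, in `L₂(0, l)`. -/
theorem ae_eq_zero_of_cosT {l : ℝ} (hl : 0 < l) {f : ℝ → ℂ}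
    (hf : MemLp f 2 (volume.restrict (Ioo 0 l)))
    (h0 : ∀ n : ℕ, cosT l f (Real.pi * n / l) = 0) :
    ∀ᵐ x : ℝ, x ∈ Ioo 0 l → f x = 0 := by
  have h : -l < l := by linarith
  refine ae_eq_zero_of_fourierCoeffOn_parityExt h 1 hf fun n => ?_
  have hz : cosT l f (Real.pi * n / l) = 0 := by
    rcases Int.eq_nat_or_neg n with ⟨m, rfl | rfl⟩
    · exact_mod_cast h0 m
    · have : cosT l f (Real.pi * (-(m : ℤ) : ℤ) / l) = cosT l f (Real.pi * m / l) := by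
        rw [cosT, cosT]
        refine intervalIntegral.integral_congr fun x _ => ?_
        rw [← Real.cos_neg]
        congr 3
        push_cast
        ring
      rw [this, h0]
  rw [fourierCoeffOn_parityExt hl h 1 hf, hz]
  ring

/-- The Riesz–Fischer theorem on `(-l, l)`. -/
theorem exists_fourierCoeffOn_eq {l : ℝ} (h : -l < l) {a : ℤ → ℂ} (ha : Memℓp a 2) :
    ∃ f : ℝ → ℂ, MemLp f 2 (volume.restrict (Ioc (-l) l)) ∧
      ∀ n, fourierCoeffOn h f n = a n := by
  have : Fact (0 < l - -l) := ⟨by linarith⟩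
  let F := (fourierBasis (T := l - -l)).repr.symm ⟨a, ha⟩
  have hFc : ∀ n, fourierCoeff F n = a n := by
    intro n
    rw [← fourierBasis_repr]
    simp [F]
  have hF : MemLp (F : AddCircle (l - -l) → ℂ) 2 volume :=
    memLp_haarAddCircle_iff.1 (Lp.memLp F)
  have hmp := AddCircle.measurePreserving_mk (l - -l) (-l)
  rw [show -l + (l - -l) = l by ring] at hmp
  refine ⟨fun x => F (x : AddCircle (l - -l)), hF.comp_measurePreserving hmp, fun n => ?_⟩
  rw [← hFc n, fourierCoeffOn_eq_integral, fourierCoeff_eq_intervalIntegral _ _ (-l)]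
  rw [show -l + (l - -l) = l by ring]

theorem integral_symm_eq {l : ℝ} {f : ℝ → ℂ} (hf : IntervalIntegrable f volume (-l) l)
    (hl : 0 < l) : ∫ x in (-l)..l, f x = ∫ x in (0 : ℝ)..l, (f x + f (-x)) := by
  have h1 : IntervalIntegrable f volume 0 l :=
    hf.mono_set (by rw [uIcc_of_le hl.le, uIcc_of_le (by linarith)]
                    exact Icc_subset_Icc_left (by linarith))
  have h2 : IntervalIntegrable f volume (-l) 0 :=
    hf.mono_set (by rw [uIcc_of_le (by linarith), uIcc_of_le (by linarith)]
                    exact Icc_subset_Icc_right (by linarith))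
  have h3 : IntervalIntegrable (fun x => f (-x)) volume 0 l := by
    simpa using ((IntervalIntegrable.iff_comp_neg (by simp)).1 h2).symm
  rw [intervalIntegral.integral_add h1 h3, ← intervalIntegral.integral_add_adjacent_intervals h2 h1,
    intervalIntegral.integral_comp_neg (fun x => f x), neg_zero, add_comm]

/-- Folding a Riesz–Fischer solution on `(-l, l)` onto `(0, l)`, with parity `s = ±1`. -/
theorem exists_sinT_cosT {l : ℝ} (hl : 0 < l) {a : ℤ → ℂ} (ha : Memℓp a 2) (s : ℂ)
    (hs : s ^ 2 = 1) :
    ∃ f : ℝ → ℂ, MemLp f 2 (volume.restrict (Ioo 0 l)) ∧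
      ∀ n : ℤ, (1 + s) * cosT l f (Real.pi * n / l)
        - Complex.I * (1 - s) * sinT l f (Real.pi * n / l) = 2 * l * (a n + s * a (-n)) := by
  have h : -l < l := by linarith
  obtain ⟨f, hf, hfa⟩ := exists_fourierCoeffOn_eq h ha
  have hl' : (l : ℂ) ≠ 0 := by exact_mod_cast hl.ne'
  have hfp : MemLp f 2 (volume.restrict (Ioo 0 l)) :=
    hf.mono_measure (Measure.restrict_mono_set _
      fun x (hx : x ∈ Ioo 0 l) => mem_Ioc.2 ⟨by linarith [hx.1], hx.2.le⟩)
  have hfn : MemLp (fun x => f (-x)) 2 (volume.restrict (Ioo 0 l)) := by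
    have h1 : MemLp f 2 (volume.restrict (Ioo (-l) 0)) :=
      hf.mono_measure (Measure.restrict_mono_set _
        fun x (hx : x ∈ Ioo (-l) 0) => mem_Ioc.2 ⟨hx.1, by linarith [hx.2]⟩)
    refine h1.comp_measurePreserving (f := fun x : ℝ => -x) ?_
    have := (Measure.measurePreserving_neg (volume : Measure ℝ)).restrict_preimage
      (measurableSet_Ioo (a := -l) (b := 0))
    simpa using this
  have hfi : IntervalIntegrable f volume (-l) l := by
    rw [intervalIntegrable_iff_integrableOn_Ioc_of_le h.le]
    exact hf.integrable (by norm_num)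
  have hg := hfp.add (hfn.const_mul s)
  refine ⟨_, hg, fun n => ?_⟩
  set φ : ℝ → ℂ := fun x => (Real.cos (Real.pi * n / l * x) : ℂ)
        - Complex.I * (Real.sin (Real.pi * n / l * x) : ℂ) with hφ
  have hφc : Continuous φ := by fun_prop
  have hφn : Continuous fun x => φ (-x) := by fun_prop
  have a1 : ∫ x in (-l)..l, f x * φ x = 2 * l * a n := by
    rw [← hfa n, fourierCoeffOn_symm]
    rw [← mul_assoc, mul_one_div_cancel (by simpa using hl'), one_mul]
  have a2 : ∫ x in (-l)..l, f x * φ (-x) = 2 * l * a (-n) := by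
    rw [← hfa (-n), fourierCoeffOn_symm, ← mul_assoc, mul_one_div_cancel (by simpa using hl'),
      one_mul]
    refine intervalIntegral.integral_congr fun x _ => ?_
    have : Real.pi * ((-n : ℤ) : ℝ) / l * x = Real.pi * n / l * -x := by push_cast; ring
    simp only [this, hφ]
  have j1 := hfi.mul_continuousOn (hφc.continuousOn (s := uIcc (-l) l))
  have j2 := hfi.mul_continuousOn (hφn.continuousOn (s := uIcc (-l) l))
  have hgi := intervalIntegrable_of_memLp hl.le hg
  have ic := intervalIntegrable_mul_cos hgi (Real.pi * n / l)
  have is := intervalIntegrable_mul_sin hgi (Real.pi * n / l)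
  have e : ∫ x in (-l)..l, (f x * φ x + s * (f x * φ (-x))) = 2 * l * (a n + s * a (-n)) := by
    rw [intervalIntegral.integral_add j1 (j2.const_mul s), intervalIntegral.integral_const_mul,
      a1, a2]
    ring
  rw [← e, integral_symm_eq (j1.add (j2.const_mul s)) hl, cosT, sinT,
    ← intervalIntegral.integral_const_mul, ← intervalIntegral.integral_const_mul,
    ← intervalIntegral.integral_sub (ic.const_mul _) (is.const_mul _)]
  refine intervalIntegral.integral_congr fun x _ => ?_
  simp only [hφ, Pi.add_apply, mul_neg, Real.cos_neg, Real.sin_neg, neg_neg]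
  push_cast
  linear_combination (f (-x) * (Complex.cos (Real.pi * n / l * x)
    + Complex.I * Complex.sin (Real.pi * n / l * x))) * hs

theorem memℓp_two_int_of_nat {a : ℤ → ℂ} (h : Memℓp (fun n : ℕ => a n) 2)
    (h0 : ∀ n : ℤ, n < 0 → a n = 0) : Memℓp a 2 := by
  rw [memℓp_two_iff] at h ⊢
  refine Summable.of_nat_of_neg h ?_
  refine summable_of_ne_finset_zero (s := {0}) fun n hn => ?_
  rw [h0 _ (by simp at hn; omega)]
  simp

/-- Riesz–Fischer for the sine system. -/
theorem exists_sinT_eq {l : ℝ} (hl : 0 < l) {a : ℕ → ℂ} (ha : Memℓp a 2) :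
    ∃ f : ℝ → ℂ, MemLp f 2 (volume.restrict (Ioo 0 l)) ∧
      ∀ n : ℕ, 1 ≤ n → sinT l f (Real.pi * n / l) = a n := by
  have hl' : (l : ℂ) ≠ 0 := by exact_mod_cast hl.ne'
  let b : ℤ → ℂ := fun n => if 0 ≤ n then (-Complex.I / l) * a n.toNat else 0
  have hb : Memℓp b 2 := by
    refine memℓp_two_int_of_nat ?_ fun n hn => by simp [b, hn]
    refine memℓp_two_of_isBigO (ha.const_smul (-Complex.I / l : ℂ)) (EventuallyEq.isBigO ?_)
    filter_upwards with n
    simp [b]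
  obtain ⟨f, hf, hfa⟩ := exists_sinT_cosT hl hb (-1) (by norm_num)
  refine ⟨f, hf, fun n hn => ?_⟩
  have := hfa n
  have hn' : n ≠ 0 := by omega
  simp [b, hn'] at this
  field_simp at this
  linear_combination -this / 2

/-- Riesz–Fischer for the cosine system. -/
theorem exists_cosT_eq {l : ℝ} (hl : 0 < l) {a : ℕ → ℂ} (ha : Memℓp a 2) :
    ∃ f : ℝ → ℂ, MemLp f 2 (volume.restrict (Ioo 0 l)) ∧
      ∀ n : ℕ, cosT l f (Real.pi * n / l) = a n := by
  have hl' : (l : ℂ) ≠ 0 := by exact_mod_cast hl.ne'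
  -- the coefficient at `n = 0` is counted twice by the even extension
  let b : ℤ → ℂ := fun n => if 0 < n then a n.toNat / l else if n = 0 then a 0 / (2 * l) else 0
  have hb : Memℓp b 2 := by
    refine memℓp_two_int_of_nat ?_ fun n hn => by simp [b, hn.not_gt, hn.ne]
    refine memℓp_two_of_isBigO (ha.const_smul (l⁻¹ : ℂ)) (EventuallyEq.isBigO ?_)
    filter_upwards [eventually_gt_atTop 0] with n hn
    simp [b, hn]
    ring
  obtain ⟨f, hf, hfa⟩ := exists_sinT_cosT hl hb 1 (by norm_num)
  refine ⟨f, hf, fun n => ?_⟩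
  have := hfa n
  rcases Nat.eq_zero_or_pos n with rfl | hn
  · simp [b] at this ⊢
    field_simp at this
    exact this
  · have hn' : ¬ ((n : ℤ) < 0) := by omega
    simp only [b, Int.natCast_pos, hn, if_true, Int.toNat_natCast, Int.neg_pos, hn', if_false,
      neg_eq_zero, Int.natCast_eq_zero, hn.ne', Int.cast_natCast] at this
    field_simp at this
    linear_combination this / 2

/-! ### Integration by parts in `W¹₂` -/

/-- Integration by parts for a primitive, by Fubini's theorem on the triangle `t ≤ x`. Only a.e.
differentiability of the primitive is available, so the classical formula does not apply. -/
theorem integral_primitive_mul {l : ℝ} (hl : 0 ≤ l) {f φ φ' : ℝ → ℂ}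
    (hf : IntervalIntegrable f volume 0 l)
    (hφ : ∀ x, HasDerivAt φ (φ' x) x) (hφ' : Continuous φ') :
    ∫ x in (0 : ℝ)..l, (∫ t in (0 : ℝ)..x, f t) * φ' x
      = φ l * (∫ t in (0 : ℝ)..l, f t) - ∫ t in (0 : ℝ)..l, f t * φ t := by
  set μ := volume.restrict (Ioc 0 l) with hμ
  have hfi : Integrable f μ := (intervalIntegrable_iff_integrableOn_Ioc_of_le hl).1 hf
  have hφi : Integrable φ' μ :=
    (intervalIntegrable_iff_integrableOn_Ioc_of_le hl).1 (hφ'.intervalIntegrable 0 l)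
  have hφc : Continuous φ := continuous_iff_continuousAt.2 fun x => (hφ x).continuousAt
  have hS : MeasurableSet {p : ℝ × ℝ | p.2 ≤ p.1} := measurableSet_le measurable_snd measurable_fst
  have hprod : Integrable ({p : ℝ × ℝ | p.2 ≤ p.1}.indicator fun p => φ' p.1 * f p.2) (μ.prod μ) :=
    (hφi.mul_prod hfi).indicator hS
  have swap := integral_integral_swap (f := fun x t =>
    {p : ℝ × ℝ | p.2 ≤ p.1}.indicator (fun p => φ' p.1 * f p.2) (x, t)) hprod
  have L : ∫ x, ∫ t, {p : ℝ × ℝ | p.2 ≤ p.1}.indicator (fun p => φ' p.1 * f p.2) (x, t) ∂μ ∂μ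
      = ∫ x in (0 : ℝ)..l, (∫ t in (0 : ℝ)..x, f t) * φ' x := by
    rw [intervalIntegral.integral_of_le hl]
    refine setIntegral_congr_fun measurableSet_Ioc fun x hx => ?_
    have : ∀ t, {p : ℝ × ℝ | p.2 ≤ p.1}.indicator (fun p => φ' p.1 * f p.2) (x, t)
        = (Iic x).indicator (fun t => φ' x * f t) t := by
      intro t
      by_cases h : t ≤ x <;> simp [h]
    simp_rw [this]
    rw [integral_indicator measurableSet_Iic, hμ, Measure.restrict_restrict measurableSet_Iic,
      inter_comm, Ioc_inter_Iic, min_eq_right hx.2, intervalIntegral.integral_of_le hx.1.le,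
      integral_const_mul, mul_comm]
  have R : ∫ t, ∫ x, {p : ℝ × ℝ | p.2 ≤ p.1}.indicator (fun p => φ' p.1 * f p.2) (x, t) ∂μ ∂μ
      = ∫ t in (0 : ℝ)..l, f t * (φ l - φ t) := by
    rw [intervalIntegral.integral_of_le hl]
    refine setIntegral_congr_fun measurableSet_Ioc fun t ht => ?_
    have : ∀ x, {p : ℝ × ℝ | p.2 ≤ p.1}.indicator (fun p => φ' p.1 * f p.2) (x, t)
        = (Ici t).indicator (fun x => φ' x * f t) x := by
      intro x
      by_cases h : t ≤ x <;> simp [h]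
    simp_rw [this]
    have hI : Ici t ∩ Ioc 0 l = Icc t l := by
      ext y
      simp only [mem_inter_iff, mem_Ici, mem_Ioc, mem_Icc]
      exact ⟨fun h => ⟨h.1, h.2.2⟩, fun h => ⟨h.1, ht.1.trans_le h.1, h.2⟩⟩
    rw [integral_indicator measurableSet_Ici, hμ, Measure.restrict_restrict measurableSet_Ici,
      hI, integral_Icc_eq_integral_Ioc, ← intervalIntegral.integral_of_le ht.2,
      intervalIntegral.integral_mul_const,
      intervalIntegral.integral_eq_sub_of_hasDerivAt (fun x _ => hφ x)
        (hφ'.intervalIntegrable _ _), mul_comm]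
  rw [← L, swap, R, ← intervalIntegral.integral_const_mul, ← intervalIntegral.integral_sub
    (hf.const_mul _) (hf.mul_continuousOn hφc.continuousOn)]
  refine intervalIntegral.integral_congr fun x _ => ?_
  ring

theorem continuousOn_primitive_Icc {l : ℝ} (hl : 0 ≤ l) {f : ℝ → ℂ}
    (hf : IntervalIntegrable f volume 0 l) :
    ContinuousOn (fun x => ∫ t in (0 : ℝ)..x, f t) (Icc 0 l) := by
  have := intervalIntegral.continuousOn_primitive_interval'
    (hf) (left_mem_uIcc)
  rwa [uIcc_of_le hl] at this

theorem IsW12WithDeriv.continuousOn {l : ℝ} (hl : 0 ≤ l) {f f' : ℝ → ℂ} (hf : IsW12WithDeriv l f f') :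
    ContinuousOn f (Icc 0 l) :=
  (continuousOn_const.add
    (continuousOn_primitive_Icc hl (intervalIntegrable_of_memLp hl hf.1))).congr hf.2

theorem IsW12WithDeriv.memLp {l : ℝ} (hl : 0 ≤ l) {f f' : ℝ → ℂ} (hf : IsW12WithDeriv l f f') :
    MemLp f 2 (volume.restrict (Ioo 0 l)) := by
  have hc := IsW12WithDeriv.continuousOn hl hf
  obtain ⟨C, hC⟩ := isCompact_Icc.exists_bound_of_continuousOn hc
  refine MemLp.of_bound ((hc.mono Ioo_subset_Icc_self).aestronglyMeasurable measurableSet_Ioo) C ?_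
  exact (ae_restrict_iff' measurableSet_Ioo).2 (.of_forall fun x hx => hC x (Ioo_subset_Icc_self hx))

theorem IsW12WithDeriv.integral_mul_deriv {l : ℝ} (hl : 0 ≤ l) {f f' φ φ' : ℝ → ℂ}
    (hf : IsW12WithDeriv l f f')
    (hφ : ∀ x, HasDerivAt φ (φ' x) x) (hφ' : Continuous φ') :
    ∫ x in (0 : ℝ)..l, f x * φ' x = f l * φ l - f 0 * φ 0 - ∫ x in (0 : ℝ)..l, f' x * φ x := by
  have hi := intervalIntegrable_of_memLp hl hf.1
  have h1 := integral_primitive_mul hl hi hφ hφ'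
  have h2 : ∫ x in (0 : ℝ)..l, φ' x = φ l - φ 0 :=
    intervalIntegral.integral_eq_sub_of_hasDerivAt (fun x _ => hφ x) (hφ'.intervalIntegrable _ _)
  have h3 : ∫ x in (0 : ℝ)..l, f x * φ' x
      = ∫ x in (0 : ℝ)..l, (f 0 * φ' x + (∫ t in (0 : ℝ)..x, f' t) * φ' x) := by
    refine intervalIntegral.integral_congr fun x hx => ?_
    rw [uIcc_of_le hl] at hx
    rw [hf.2 x hx]
    ring
  have h4 : IntervalIntegrable (fun x => (∫ t in (0 : ℝ)..x, f' t) * φ' x) volume 0 l := by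
    refine ContinuousOn.intervalIntegrable ?_
    rw [uIcc_of_le hl]
    exact (continuousOn_primitive_Icc hl hi).mul hφ'.continuousOn
  rw [h3, intervalIntegral.integral_add ((hφ'.intervalIntegrable 0 l).const_mul _) h4,
    intervalIntegral.integral_const_mul, h1, h2, hf.2 l ⟨hl, le_rfl⟩]
  ring

theorem IsW12WithDeriv.cosT_deriv {l : ℝ} (hl : 0 ≤ l) {f f' : ℝ → ℂ} (hf : IsW12WithDeriv l f f') (z : ℝ) :
    cosT l f' z = f l * Real.cos (z * l) - f 0 + z * sinT l f z := by
  have h := IsW12WithDeriv.integral_mul_deriv hl hf (φ := fun x => (Real.cos (z * x) : ℂ))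
    (φ' := fun x => ((-Real.sin (z * x) * z : ℝ) : ℂ)) (fun x => by
      have : HasDerivAt (fun x : ℝ => Real.cos (z * x)) (-Real.sin (z * x) * z) x := by
        simpa using ((hasDerivAt_id x).const_mul z).cos
      exact this.ofReal_comp) (by fun_prop)
  have e : ∫ x in (0 : ℝ)..l, f x * ((-Real.sin (z * x) * z : ℝ) : ℂ) = -z * sinT l f z := by
    rw [sinT, ← intervalIntegral.integral_const_mul]
    refine intervalIntegral.integral_congr fun x _ => ?_
    push_cast
    ring
  simp only [mul_zero, Real.cos_zero, Complex.ofReal_one, mul_one] at h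
  rw [e] at h
  rw [cosT]
  linear_combination h

theorem IsW12WithDeriv.sinT_deriv {l : ℝ} (hl : 0 ≤ l) {f f' : ℝ → ℂ} (hf : IsW12WithDeriv l f f') (z : ℝ) :
    sinT l f' z = f l * Real.sin (z * l) - z * cosT l f z := by
  have h := IsW12WithDeriv.integral_mul_deriv hl hf (φ := fun x => (Real.sin (z * x) : ℂ))
    (φ' := fun x => ((Real.cos (z * x) * z : ℝ) : ℂ)) (fun x => by
      have : HasDerivAt (fun x : ℝ => Real.sin (z * x)) (Real.cos (z * x) * z) x := by
        simpa using ((hasDerivAt_id x).const_mul z).sin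
      exact this.ofReal_comp) (by fun_prop)
  have e : ∫ x in (0 : ℝ)..l, f x * ((Real.cos (z * x) * z : ℝ) : ℂ) = z * cosT l f z := by
    rw [cosT, ← intervalIntegral.integral_const_mul]
    refine intervalIntegral.integral_congr fun x _ => ?_
    push_cast
    ring
  simp only [mul_zero, Real.sin_zero, Complex.ofReal_zero, sub_zero] at h
  rw [e] at h
  rw [sinT]
  linear_combination h

theorem isW12WithDeriv_primitive {l : ℝ} {f' : ℝ → ℂ}
    (hf : MemLp f' 2 (volume.restrict (Ioo 0 l))) (a : ℂ) :
    IsW12WithDeriv l (fun x => a + ∫ t in (0 : ℝ)..x, f' t) f' :=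
  ⟨hf, fun x _ => by simp⟩

theorem sin_pi_nat_div {l : ℝ} (hl : l ≠ 0) (n : ℕ) : Real.sin (Real.pi * n / l * l) = 0 := by
  rw [div_mul_cancel₀ _ hl, mul_comm, Real.sin_nat_mul_pi]

theorem cos_pi_nat_div {l : ℝ} (hl : l ≠ 0) (n : ℕ) :
    Real.cos (Real.pi * n / l * l) = (-1) ^ n := by
  rw [div_mul_cancel₀ _ hl, mul_comm, Real.cos_nat_mul_pi]

theorem sinT_sub {l : ℝ} {f g : ℝ → ℂ} (hf : IntervalIntegrable f volume 0 l)
    (hg : IntervalIntegrable g volume 0 l) (z : ℝ) :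
    sinT l (f - g) z = sinT l f z - sinT l g z := by
  rw [sinT, sinT, sinT, ← intervalIntegral.integral_sub (intervalIntegrable_mul_sin hf z)
    (intervalIntegrable_mul_sin hg z)]
  simp [sub_mul]

theorem cosT_sub {l : ℝ} {f g : ℝ → ℂ} (hf : IntervalIntegrable f volume 0 l)
    (hg : IntervalIntegrable g volume 0 l) (z : ℝ) :
    cosT l (f - g) z = cosT l f z - cosT l g z := by
  rw [cosT, cosT, cosT, ← intervalIntegral.integral_sub (intervalIntegrable_mul_cos hf z)
    (intervalIntegrable_mul_cos hg z)]
  simp [sub_mul]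

/-- A function whose sine coefficients have the asymptotics `ν⁻¹ (a - (-1)ⁿ b + ℓ²)`, `ν = πn/l`,
is a `W¹₂` function with boundary values `a` and `b`. -/
theorem exists_W12_of_sinT {l : ℝ} (hl : 0 < l) {f : ℝ → ℂ}
    (hf : MemLp f 2 (volume.restrict (Ioo 0 l))) (a b : ℂ) {r : ℕ → ℂ} (hr : Memℓp r 2)
    (h : ∀ n : ℕ, 1 ≤ n → (Real.pi * n / l : ℝ) * sinT l f (Real.pi * n / l)
      = a - (-1) ^ n * b + r n) :
    ∃ g g' : ℝ → ℂ, IsW12WithDeriv l g g' ∧ g 0 = a ∧ g l = b ∧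
      ∀ᵐ x : ℝ, x ∈ Ioo 0 l → f x = g x := by
  -- the zeroth cosine coefficient of `g'` is free; it is used to prescribe `g l`
  let s : ℕ → ℂ := fun n => if n = 0 then b - a else r n
  have hs : Memℓp s 2 := memℓp_two_of_isBigO hr (EventuallyEq.isBigO (by
    filter_upwards [eventually_gt_atTop 0] with n hn
    simp [s, hn.ne']))
  obtain ⟨g', hg', hc⟩ := exists_cosT_eq hl hs
  let g : ℝ → ℂ := fun x => a + ∫ t in (0 : ℝ)..x, g' t
  have hg : IsW12WithDeriv l g g' := isW12WithDeriv_primitive hg' a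
  have hg0 : g 0 = a := by simp [g]
  have hgl : g l = b := by
    have := hc 0
    simp only [cosT, Nat.cast_zero, mul_zero, zero_div, zero_mul, Real.cos_zero,
      Complex.ofReal_one, mul_one, s, if_true] at this
    simp [g, this]
  refine ⟨g, g', hg, hg0, hgl, ?_⟩
  have hgm := IsW12WithDeriv.memLp hl.le hg
  have key := ae_eq_zero_of_sinT hl (hf.sub hgm) fun n hn => by
    have hν : ((Real.pi * n / l : ℝ) : ℂ) ≠ 0 := by
      have : (0 : ℝ) < n := by exact_mod_cast hn
      exact_mod_cast (by positivity : Real.pi * n / l ≠ 0)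
    rw [sinT_sub (intervalIntegrable_of_memLp hl.le hf) (intervalIntegrable_of_memLp hl.le hgm)]
    have h1 := IsW12WithDeriv.cosT_deriv hl.le hg (Real.pi * n / l)
    rw [hc, hg0, hgl, cos_pi_nat_div hl.ne'] at h1
    have h2 := h n hn
    have hn0 : n ≠ 0 := by omega
    simp only [s, hn0, if_false] at h1
    push_cast at h1 h2 hν
    refine (mul_eq_zero.1 ?_).resolve_left hν
    linear_combination h2 + h1
  filter_upwards [key] with x hx hx0
  exact sub_eq_zero.1 (hx hx0)

/-- A function whose cosine coefficients are `o(1/n)` in the `ℓ²` sense is a `W¹₂` function. -/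
theorem exists_W12_of_cosT {l : ℝ} (hl : 0 < l) {f : ℝ → ℂ}
    (hf : MemLp f 2 (volume.restrict (Ioo 0 l)))
    (h : Memℓp (fun n : ℕ => (Real.pi * n / l : ℝ) * cosT l f (Real.pi * n / l)) 2) :
    ∃ g g' : ℝ → ℂ, IsW12WithDeriv l g g' ∧ ∀ᵐ x : ℝ, x ∈ Ioo 0 l → f x = g x := by
  obtain ⟨g', hg', hs⟩ := exists_sinT_eq hl h.neg
  -- the additive constant is fixed by the zeroth cosine coefficient
  let p : ℝ → ℂ := fun x => ∫ t in (0 : ℝ)..x, g' t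
  let a : ℂ := (cosT l f 0 - cosT l p 0) / l
  let g : ℝ → ℂ := fun x => a + ∫ t in (0 : ℝ)..x, g' t
  have hg : IsW12WithDeriv l g g' := isW12WithDeriv_primitive hg' a
  refine ⟨g, g', hg, ?_⟩
  have hgm := IsW12WithDeriv.memLp hl.le hg
  have hgi := intervalIntegrable_of_memLp hl.le hgm
  have hl' : (l : ℂ) ≠ 0 := by exact_mod_cast hl.ne'
  have hpi : IntervalIntegrable p volume 0 l := by
    refine ContinuousOn.intervalIntegrable ?_
    rw [uIcc_of_le hl.le]
    exact continuousOn_primitive_Icc hl.le (intervalIntegrable_of_memLp hl.le hg')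
  have key := ae_eq_zero_of_cosT hl (hf.sub hgm) fun n => by
    rw [cosT_sub (intervalIntegrable_of_memLp hl.le hf) hgi]
    rcases Nat.eq_zero_or_pos n with rfl | hn
    · have : cosT l g 0 = a * l + cosT l p 0 := by
        simp only [cosT, zero_mul, Real.cos_zero, Complex.ofReal_one, mul_one]
        rw [intervalIntegral.integral_add (by simp) hpi]
        simp [mul_comm]
      simp only [Nat.cast_zero, mul_zero, zero_div, this, a]
      field_simp
      ring
    · have hν : ((Real.pi * n / l : ℝ) : ℂ) ≠ 0 := by
        have : (0 : ℝ) < n := by exact_mod_cast hn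
        exact_mod_cast (by positivity : Real.pi * n / l ≠ 0)
      have h1 := IsW12WithDeriv.sinT_deriv hl.le hg (Real.pi * n / l)
      rw [hs n hn, sin_pi_nat_div hl.ne'] at h1
      refine (mul_eq_zero.1 ?_).resolve_left hν
      simp only [Pi.neg_apply] at h1
      push_cast at h1 ⊢
      linear_combination -h1
  filter_upwards [key] with x hx hx0
  exact sub_eq_zero.1 (hx hx0)

/-! ### Perturbation of the frequencies -/

theorem abs_cos_add_sub_le (a t : ℝ) :
    |Real.cos (a + t) - Real.cos a + t * Real.sin a| ≤ 3 * t ^ 2 := by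
  have h1 : |Real.cos t - 1| ≤ t ^ 2 := by
    rw [abs_le]
    constructor <;> nlinarith [Real.one_sub_sq_div_two_le_cos (x := t), Real.cos_le_one t]
  have h2 : |Real.sin t - t| ≤ 2 * t ^ 2 := by
    have key : ∀ t : ℝ, 0 ≤ t → |Real.sin t - t| ≤ 2 * t ^ 2 := by
      intro t ht
      have hs := Real.sin_le ht
      rw [abs_of_nonpos (by linarith)]
      rcases le_total t 1 with h | h
      · have := Real.sin_ge_sub_cube ht
        nlinarith [mul_nonneg (sq_nonneg t) (sub_nonneg.2 h), sq_nonneg t]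
      · nlinarith [Real.neg_one_le_sin t]
    rcases le_total 0 t with h | h
    · exact key t h
    · have := key (-t) (by linarith)
      rw [Real.sin_neg, ← abs_neg] at this
      convert this using 1
      · congr 1; ring
      · ring
  have e : Real.cos (a + t) - Real.cos a + t * Real.sin a
      = Real.cos a * (Real.cos t - 1) - Real.sin a * (Real.sin t - t) := by
    rw [Real.cos_add]; ring
  rw [e]
  calc _ ≤ |Real.cos a * (Real.cos t - 1)| + |Real.sin a * (Real.sin t - t)| := abs_sub _ _
    _ ≤ 1 * |Real.cos t - 1| + 1 * |Real.sin t - t| := by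
        rw [abs_mul, abs_mul]
        gcongr
        · exact Real.abs_cos_le_one a
        · exact Real.abs_sin_le_one a
    _ ≤ 3 * t ^ 2 := by linarith

theorem abs_sin_add_sub_le (a t : ℝ) :
    |Real.sin (a + t) - Real.sin a - t * Real.cos a| ≤ 3 * t ^ 2 := by
  have := abs_cos_add_sub_le (a - Real.pi / 2) t
  rw [show a - Real.pi / 2 + t = (a + t) - Real.pi / 2 by ring, Real.cos_sub_pi_div_two,
    Real.cos_sub_pi_div_two, Real.sin_sub_pi_div_two] at this
  convert this using 2
  ring

/-- Multiplication by `x` preserves `L₂(0, l)`. -/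
theorem memLp_id_mul {l : ℝ} {f : ℝ → ℂ}
    (hf : MemLp f 2 (volume.restrict (Ioo 0 l))) :
    MemLp (fun x : ℝ => (x : ℂ) * f x) 2 (volume.restrict (Ioo 0 l)) := by
  refine hf.of_le_mul (c := l) ?_ ?_
  · exact (Complex.continuous_ofReal.aestronglyMeasurable).mul hf.1
  · refine (ae_restrict_iff' measurableSet_Ioo).2 (.of_forall fun x hx => ?_)
    rw [norm_mul, Complex.norm_real, Real.norm_of_nonneg hx.1.le]
    exact mul_le_mul_of_nonneg_right hx.2.le (norm_nonneg _)

theorem norm_integral_mul_le {l : ℝ} (hl : 0 ≤ l) {f : ℝ → ℂ}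
    (hf : IntervalIntegrable f volume 0 l) {r : ℝ → ℝ} (hr : Continuous r) {C : ℝ}
    (h : ∀ x ∈ Icc 0 l, |r x| ≤ C) :
    ‖∫ x in (0 : ℝ)..l, f x * (r x : ℂ)‖ ≤ C * ∫ x in (0 : ℝ)..l, ‖f x‖ := by
  rw [← intervalIntegral.integral_const_mul]
  refine (intervalIntegral.norm_integral_le_integral_norm hl).trans ?_
  refine intervalIntegral.integral_mono_on hl
    (hf.mul_continuousOn (Complex.continuous_ofReal.comp hr).continuousOn).norm
    (hf.norm.const_mul C) fun x hx => ?_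
  rw [norm_mul, Complex.norm_real, mul_comm]
  exact mul_le_mul_of_nonneg_right (h x hx) (norm_nonneg _)

/-- First-order Taylor estimate of the cosine transform in the frequency; the derivative is the sine
transform of `x f(x)`, up to sign. -/
theorem norm_cosT_add_sub_le {l : ℝ} (hl : 0 ≤ l) {f : ℝ → ℂ}
    (hf : MemLp f 2 (volume.restrict (Ioo 0 l))) (a δ : ℝ) :
    ‖cosT l f (a + δ) - cosT l f a + δ * sinT l (fun x : ℝ => x * f x) a‖
      ≤ 3 * δ ^ 2 * l ^ 2 * ∫ x in (0 : ℝ)..l, ‖f x‖ := by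
  have hi := intervalIntegrable_of_memLp hl hf
  have hxi := intervalIntegrable_of_memLp hl (memLp_id_mul hf)
  rw [cosT, cosT, sinT, ← intervalIntegral.integral_const_mul,
    ← intervalIntegral.integral_sub (intervalIntegrable_mul_cos hi _)
      (intervalIntegrable_mul_cos hi _),
    ← intervalIntegral.integral_add ((intervalIntegrable_mul_cos hi _).sub
      (intervalIntegrable_mul_cos hi _)) ((intervalIntegrable_mul_sin hxi _).const_mul _)]
  convert norm_integral_mul_le hl hi (C := 3 * δ ^ 2 * l ^ 2)
    (r := fun x => Real.cos (a * x + δ * x) - Real.cos (a * x) + δ * x * Real.sin (a * x))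
    (by fun_prop) (fun x hx => ?_) using 4 with x
  · rw [add_mul]; push_cast; ring
  · refine (abs_cos_add_sub_le _ _).trans ?_
    rw [mul_pow, ← mul_assoc]
    gcongr
    · exact hx.1
    · exact hx.2

theorem norm_sinT_add_sub_le {l : ℝ} (hl : 0 ≤ l) {f : ℝ → ℂ}
    (hf : MemLp f 2 (volume.restrict (Ioo 0 l))) (a δ : ℝ) :
    ‖sinT l f (a + δ) - sinT l f a - δ * cosT l (fun x : ℝ => x * f x) a‖
      ≤ 3 * δ ^ 2 * l ^ 2 * ∫ x in (0 : ℝ)..l, ‖f x‖ := by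
  have hi := intervalIntegrable_of_memLp hl hf
  have hxi := intervalIntegrable_of_memLp hl (memLp_id_mul hf)
  rw [sinT, sinT, cosT, ← intervalIntegral.integral_const_mul,
    ← intervalIntegral.integral_sub (intervalIntegrable_mul_sin hi _)
      (intervalIntegrable_mul_sin hi _),
    ← intervalIntegral.integral_sub ((intervalIntegrable_mul_sin hi _).sub
      (intervalIntegrable_mul_sin hi _)) ((intervalIntegrable_mul_cos hxi _).const_mul _)]
  convert norm_integral_mul_le hl hi (C := 3 * δ ^ 2 * l ^ 2)
    (r := fun x => Real.sin (a * x + δ * x) - Real.sin (a * x) - δ * x * Real.cos (a * x))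
    (by fun_prop) (fun x hx => ?_) using 4 with x
  · rw [add_mul]; push_cast; ring
  · refine (abs_sin_add_sub_le _ _).trans ?_
    rw [mul_pow, ← mul_assoc]
    gcongr
    · exact hx.1
    · exact hx.2

/-- If `D n = δₙ bₙ + O(δₙ²)` with `δₙ = O(1/n)` and `b ∈ ℓ²`, then `n D n ∈ ℓ²`. -/
theorem memℓp_nat_mul_of_norm_sub_le {D b : ℕ → ℂ} {δ : ℕ → ℝ} {C : ℝ}
    (hδ : δ =O[atTop] fun n : ℕ => (n : ℝ)⁻¹) (hb : Memℓp b 2)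
    (h : ∀ n, ‖D n - δ n * b n‖ ≤ C * δ n ^ 2) : Memℓp (fun n : ℕ => (n : ℂ) * D n) 2 := by
  have hδ' : (fun n => (δ n : ℂ)) =O[atTop] fun n : ℕ => (n : ℂ)⁻¹ := by
    refine IsBigO.of_norm_norm ?_
    simpa using hδ.norm_left.norm_right
  have hn : (fun n : ℕ => (n : ℂ)) =O[atTop] fun n : ℕ => (n : ℂ) := isBigO_refl _ _
  have hnn : (fun n : ℕ => (n : ℂ) * (n : ℂ)⁻¹) =ᶠ[atTop] fun _ => (1 : ℂ) := by
    filter_upwards [eventually_gt_atTop 0] with n hn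
    exact mul_inv_cancel₀ (by exact_mod_cast hn.ne')
  have h1 : Memℓp (fun n : ℕ => ((n : ℂ) * δ n) * b n) 2 :=
    memℓp_two_bdd_mul hb ((hn.mul hδ').trans_eventuallyEq hnn)
  have h2 : (fun n => D n - δ n * b n) =O[atTop] fun n : ℕ => (n : ℂ)⁻¹ * (n : ℂ)⁻¹ := by
    refine IsBigO.trans (IsBigO.of_bound C (.of_forall fun n => ?_)) (hδ'.mul hδ')
    simpa [← sq] using h n
  have h3 : Memℓp (fun n : ℕ => (n : ℂ) * (D n - δ n * b n)) 2 := by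
    refine memℓp_two_of_isBigO memℓp_two_inv ((hn.mul h2).trans_eventuallyEq ?_)
    filter_upwards [hnn] with n hn
    rw [← mul_assoc, hn, one_mul]
  convert h1.add h3 using 1
  ext n
  simp only [Pi.add_apply]
  ring

/-- A perturbation of the frequencies `πn/l` by `O(1/n)` changes the cosine transform of an `L₂`
function by `n⁻¹ ℓ²`: the first-order term is `O(1/n)` times the sine coefficients of the `L₂`
function `x f(x)`. -/
theorem memℓp_nat_mul_cosT_sub {l : ℝ} (hl : 0 < l) {f : ℝ → ℂ}
    (hf : MemLp f 2 (volume.restrict (Ioo 0 l))) {z : ℕ → ℝ}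
    (hz : (fun n : ℕ => z n - Real.pi * n / l) =O[atTop] fun n : ℕ => (n : ℝ)⁻¹) :
    Memℓp (fun n : ℕ => (n : ℂ) * (cosT l f (z n) - cosT l f (Real.pi * n / l))) 2 := by
  refine memℓp_nat_mul_of_norm_sub_le (C := 3 * l ^ 2 * ∫ x in (0 : ℝ)..l, ‖f x‖) hz
    (memℓp_sinT hl (memLp_id_mul hf)).neg fun n => ?_
  have := norm_cosT_add_sub_le hl.le hf (Real.pi * n / l) (z n - Real.pi * n / l)
  rw [add_sub_cancel] at this
  convert this using 1
  · simp only [Pi.neg_apply]; ring_nf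
  · ring

/-- The analogue of `memℓp_nat_mul_cosT_sub` for the sine transform. -/
theorem memℓp_nat_mul_sinT_sub {l : ℝ} (hl : 0 < l) {f : ℝ → ℂ}
    (hf : MemLp f 2 (volume.restrict (Ioo 0 l))) {z : ℕ → ℝ}
    (hz : (fun n : ℕ => z n - Real.pi * n / l) =O[atTop] fun n : ℕ => (n : ℝ)⁻¹) :
    Memℓp (fun n : ℕ => (n : ℂ) * (sinT l f (z n) - sinT l f (Real.pi * n / l))) 2 := by
  refine memℓp_nat_mul_of_norm_sub_le (C := 3 * l ^ 2 * ∫ x in (0 : ℝ)..l, ‖f x‖) hz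
    (memℓp_cosT hl (memLp_id_mul hf)) fun n => ?_
  have := norm_sinT_add_sub_le hl.le hf (Real.pi * n / l) (z n - Real.pi * n / l)
  rw [add_sub_cancel] at this
  convert this using 1
  ring

theorem memℓp_two_isBigO_one {a : ℕ → ℂ} (ha : Memℓp a 2) :
    a =O[atTop] fun _ => (1 : ℂ) := by
  obtain ⟨C, hC⟩ := (Memℓp.of_exponent_ge (p := ⊤) ha le_top).bddAbove
  exact IsBigO.of_bound C (.of_forall fun n => by simpa using hC ⟨n, rfl⟩)

theorem isBigO_natCast_of_sub {l : ℝ} (hl : 0 < l) {z : ℕ → ℝ}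
    (hz : (fun n : ℕ => z n - Real.pi * n / l) =O[atTop] fun n : ℕ => (n : ℝ)⁻¹) :
    (fun n : ℕ => (n : ℝ)) =O[atTop] z := by
  have h0 : Tendsto (fun n : ℕ => z n - Real.pi * n / l) atTop (nhds 0) :=
    hz.trans_tendsto tendsto_inv_atTop_nhds_zero_nat
  have h1 : Tendsto (fun n : ℕ => Real.pi * n / l) atTop atTop := by
    have := (tendsto_natCast_atTop_atTop (R := ℝ)).const_mul_atTop (r := Real.pi / l)
      (by positivity)
    refine this.congr fun n => by ring
  refine IsBigO.of_bound (2 * l / Real.pi) ?_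
  filter_upwards [h0.eventually (lt_mem_nhds (show (-1 : ℝ) < 0 by norm_num)),
    h1.eventually_ge_atTop 2] with n hn1 hn2
  have hzn : Real.pi * n / l ≤ 2 * z n := by linarith
  have hz0 : 0 ≤ z n := by linarith
  rw [Real.norm_of_nonneg (Nat.cast_nonneg n), Real.norm_of_nonneg hz0]
  rw [div_le_iff₀ hl] at hzn
  rw [div_mul_eq_mul_div, le_div_iff₀ Real.pi_pos]
  linarith

theorem isBigO_inv_natCast_of_sub {l : ℝ} (hl : 0 < l) {z : ℕ → ℝ}
    (hz : (fun n : ℕ => z n - Real.pi * n / l) =O[atTop] fun n : ℕ => (n : ℝ)⁻¹) :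
    (fun n : ℕ => (z n)⁻¹) =O[atTop] fun n : ℕ => (n : ℝ)⁻¹ := by
  refine (isBigO_natCast_of_sub hl hz).inv_rev ?_
  filter_upwards [eventually_gt_atTop 0] with n hn h
  exact absurd h (by exact_mod_cast hn.ne')

theorem isBigO_ofReal {u v : ℕ → ℝ} (h : u =O[atTop] v) :
    (fun n => (u n : ℂ)) =O[atTop] fun n => (v n : ℂ) := by
  refine IsBigO.of_norm_norm ?_
  simpa using h.norm_left.norm_right

theorem sinT_isBigO_one {l : ℝ} (hl : 0 < l) {f : ℝ → ℂ}
    (hf : MemLp f 2 (volume.restrict (Ioo 0 l))) (z : ℕ → ℝ) :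
    (fun n => sinT l f (z n)) =O[atTop] fun _ => (1 : ℂ) := by
  refine IsBigO.of_bound (∫ x in (0 : ℝ)..l, ‖f x‖) (.of_forall fun n => ?_)
  simpa [sinT] using norm_integral_mul_le hl.le (intervalIntegrable_of_memLp hl.le hf)
    (r := fun x => Real.sin (z n * x)) (by fun_prop) (C := 1) fun x _ => Real.abs_sin_le_one _

theorem cosT_congr_ae {l : ℝ} (hl : 0 ≤ l) {f g : ℝ → ℂ}
    (h : ∀ᵐ x : ℝ, x ∈ Ioo 0 l → f x = g x) (z : ℝ) : cosT l f z = cosT l g z := by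
  rw [cosT, cosT, intervalIntegral.integral_of_le hl, intervalIntegral.integral_of_le hl,
    integral_Ioc_eq_integral_Ioo, integral_Ioc_eq_integral_Ioo]
  refine setIntegral_congr_ae measurableSet_Ioo ?_
  filter_upwards [h] with x hx hx0
  rw [hx hx0]

theorem sinT_congr_ae {l : ℝ} (hl : 0 ≤ l) {f g : ℝ → ℂ}
    (h : ∀ᵐ x : ℝ, x ∈ Ioo 0 l → f x = g x) (z : ℝ) : sinT l f z = sinT l g z := by
  rw [sinT, sinT, intervalIntegral.integral_of_le hl, intervalIntegral.integral_of_le hl,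
    integral_Ioc_eq_integral_Ioo, integral_Ioc_eq_integral_Ioo]
  refine setIntegral_congr_ae measurableSet_Ioo ?_
  filter_upwards [h] with x hx hx0
  rw [hx hx0]

/-- A function whose cosine transform has the asymptotics `z⁻² (a + (-1)ⁿ b + ℓ²)` at frequencies
`z = zₙ` with `zₙ = πn/l + O(1/n)` and `zₙ sin zₙl = (-1)ⁿ c + ℓ²` is a `W²₂` function. The first
pass through the cosine system gives `W¹₂`; integration by parts then moves the problem to the
sine transform of the derivative. -/
theorem exists_W22_of_cosT {l : ℝ} (hl : 0 < l) {f : ℝ → ℂ}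
    (hf : MemLp f 2 (volume.restrict (Ioo 0 l))) {z : ℕ → ℝ}
    (hz : (fun n : ℕ => z n - Real.pi * n / l) =O[atTop] fun n : ℕ => (n : ℝ)⁻¹)
    {c : ℂ} (hs : Memℓp (fun n => (z n * Real.sin (z n * l) : ℂ) - (-1) ^ n * c) 2)
    {a b : ℂ} (h : Memℓp (fun n => (z n : ℂ) ^ 2 * cosT l f (z n) - (a + (-1) ^ n * b)) 2) :
    ∃ g g' g'' : ℝ → ℂ, IsW12WithDeriv l g g' ∧ IsW12WithDeriv l g' g'' ∧
      ∀ᵐ x : ℝ, x ∈ Ioo 0 l → f x = g x := by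
  have hnn : (fun n : ℕ => (n : ℂ) * (n : ℂ)⁻¹) =ᶠ[atTop] fun _ => (1 : ℂ) := by
    filter_upwards [eventually_gt_atTop 0] with n hn
    exact mul_inv_cancel₀ (by exact_mod_cast hn.ne')
  have hzi : (fun n : ℕ => (z n : ℂ)⁻¹) =O[atTop] fun n : ℕ => (n : ℂ)⁻¹ := by
    simpa using isBigO_ofReal (isBigO_inv_natCast_of_sub hl hz)
  have hz0 : ∀ᶠ n in atTop, (z n : ℂ) ≠ 0 := by
    have := (isBigO_natCast_of_sub hl hz).eq_zero_imp
    filter_upwards [this, eventually_gt_atTop 0] with n hn hn0 h0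
    exact absurd (hn (by exact_mod_cast h0)) (by exact_mod_cast hn0.ne')
  have hbdd : (fun n => (z n : ℂ) ^ 2 * cosT l f (z n)) =O[atTop] fun _ => (1 : ℂ) := by
    have h1 : (fun n : ℕ => a + (-1) ^ n * b) =O[atTop] fun _ => (1 : ℂ) := by
      refine IsBigO.of_bound (‖a‖ + ‖b‖) (.of_forall fun n => ?_)
      simpa using norm_add_le a ((-1) ^ n * b)
    simpa using (memℓp_two_isBigO_one h).add h1
  have s1 : Memℓp (fun n : ℕ => (n : ℂ) * cosT l f (z n)) 2 := by
    refine memℓp_two_of_isBigO memℓp_two_inv ?_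
    have h1 : (fun n : ℕ => (n : ℂ) * cosT l f (z n)) =ᶠ[atTop]
        fun n : ℕ => (n : ℂ) * ((z n : ℂ)⁻¹ * (z n : ℂ)⁻¹) *
          ((z n : ℂ) ^ 2 * cosT l f (z n)) := by
      filter_upwards [hz0] with n hn
      field_simp
    refine h1.trans_isBigO ((((isBigO_refl (fun n : ℕ => (n : ℂ)) atTop).mul
      (hzi.mul hzi)).mul hbdd).trans_eventuallyEq ?_)
    filter_upwards [hnn] with n hn
    rw [← mul_assoc, hn, one_mul, mul_one]
  have s2 : Memℓp (fun n : ℕ => (Real.pi * n / l : ℝ) * cosT l f (Real.pi * n / l)) 2 := by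
    convert (s1.sub (memℓp_nat_mul_cosT_sub hl hf hz)).const_smul (Real.pi / l : ℂ) using 1
    ext n
    simp only [Pi.smul_apply, Pi.sub_apply, smul_eq_mul]
    push_cast
    ring
  obtain ⟨g, g', hg, hfg⟩ := exists_W12_of_cosT hl hf s2
  -- `z sinT g' z = g(l) z sin zl - z² cosT g z`, and then `z` is moved to `πn/l`
  simp only [cosT_congr_ae hl.le hfg] at h
  have s3 : Memℓp (fun n : ℕ => (z n - Real.pi * n / l : ℝ) * sinT l g' (z n)) 2 := by
    refine memℓp_two_of_isBigO memℓp_two_inv ?_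
    simpa using (isBigO_ofReal hz).mul (sinT_isBigO_one hl hg.1 z)
  have s4 := (memℓp_nat_mul_sinT_sub hl hg.1 hz).const_smul (Real.pi / l : ℂ)
  have s5 := (((hs.const_smul (g l)).sub h).sub s3).sub s4
  obtain ⟨k, k', hk, -, -, hgk⟩ := exists_W12_of_sinT hl hg.1 (-a) (b - g l * c) s5
    fun n hn => by
      have := IsW12WithDeriv.sinT_deriv hl.le hg (z n)
      simp only [Pi.smul_apply, Pi.sub_apply, smul_eq_mul]
      push_cast at this ⊢
      linear_combination (z n : ℂ) * this
  -- the derivative of `g` may be replaced by its absolutely continuous version `k`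
  have hint : ∀ x ∈ Icc 0 l, ∫ t in (0 : ℝ)..x, g' t = ∫ t in (0 : ℝ)..x, k t := by
    intro x hx
    rw [intervalIntegral.integral_of_le hx.1, intervalIntegral.integral_of_le hx.1,
      integral_Ioc_eq_integral_Ioo, integral_Ioc_eq_integral_Ioo]
    refine setIntegral_congr_ae measurableSet_Ioo ?_
    filter_upwards [hgk] with t ht ht0
    exact ht ⟨ht0.1, ht0.2.trans_le hx.2⟩
  refine ⟨g, k, k', ⟨IsW12WithDeriv.memLp hl.le hk, fun x hx => ?_⟩, hk, hfg⟩
  rw [hg.2 x hx, hint x hx]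

/-! ### Asymptotics of the zeros of `c₂` -/

section Zeros

variable {d l : ℝ} {z : ℕ → ℝ}

theorem IsZeroSelection.le (hl : 0 < l) (hz : IsZeroSelection d l z) {n : ℕ} (hn : 1 ≤ n) :
    Real.pi * n / (2 * l) ≤ z n := by
  refine le_trans ?_ (hz n hn).1.1.le
  have h1 : (1 : ℝ) ≤ n := by exact_mod_cast hn
  rw [← sub_nonneg]
  have : Real.pi * n / l - Real.pi / (2 * l) - Real.pi * n / (2 * l)
      = Real.pi * (n - 1) / (2 * l) := by
    field_simp
    ring
  rw [this]
  have := sub_nonneg.2 h1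
  positivity

theorem IsZeroSelection.pos (hl : 0 < l) (hz : IsZeroSelection d l z) {n : ℕ} (hn : 1 ≤ n) :
    0 < z n := by
  have h1 : (0 : ℝ) < n := by exact_mod_cast hn
  exact (by positivity : 0 < Real.pi * n / (2 * l)).trans_le (hz.le hl hn)

/-- The equation `c₂(z²) = 0` cleared of its denominator. -/
theorem IsZeroSelection.cos_eq (hl : 0 < l) (hz : IsZeroSelection d l z) {n : ℕ} (hn : 1 ≤ n) :
    d * z n * Real.cos (z n * l) = (d ^ 2 * z n ^ 2 - 1) * Real.sin (z n * l) := by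
  have h0 := (hz.pos hl hn).ne'
  have h := (hz n hn).2
  rw [c₂] at h
  field_simp at h
  linear_combination h

theorem IsZeroSelection.sin_ne_zero (hd : 0 < d) (hl : 0 < l) (hz : IsZeroSelection d l z)
    {n : ℕ} (hn : 1 ≤ n) : Real.sin (z n * l) ≠ 0 := by
  intro h
  have h1 := hz.cos_eq hl hn
  rw [h, mul_zero] at h1
  have h2 := (mul_eq_zero.1 h1).resolve_left (mul_pos hd (hz.pos hl hn)).ne'
  have := Real.sin_sq_add_cos_sq (z n * l)
  rw [h, h2] at this
  norm_num at this

theorem IsZeroSelection.abs_phase_lt (hl : 0 < l) (hz : IsZeroSelection d l z) {n : ℕ}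
    (hn : 1 ≤ n) : |z n * l - Real.pi * n| < Real.pi / 2 := by
  obtain ⟨h1, h2⟩ := (hz n hn).1
  have e1 : (Real.pi * n / l - Real.pi / (2 * l)) * l = Real.pi * n - Real.pi / 2 := by field_simp
  have e2 : (Real.pi * n / l + Real.pi / (2 * l)) * l = Real.pi * n + Real.pi / 2 := by field_simp
  have h1' := mul_lt_mul_of_pos_right h1 hl
  have h2' := mul_lt_mul_of_pos_right h2 hl
  rw [e1] at h1'
  rw [e2] at h2'
  rw [abs_lt]
  constructor <;> linarith

/-- The equation `c₂(z²) = 0` in terms of the phase `θₙ = zₙl - πn`. -/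
theorem IsZeroSelection.phase_eq (hl : 0 < l) (hz : IsZeroSelection d l z) {n : ℕ}
    (hn : 1 ≤ n) : d * z n * Real.cos (z n * l - Real.pi * n)
      = (d ^ 2 * z n ^ 2 - 1) * Real.sin (z n * l - Real.pi * n) := by
  rw [mul_comm Real.pi, Real.cos_sub_nat_mul_pi, Real.sin_sub_nat_mul_pi]
  linear_combination (-1) ^ n * hz.cos_eq hl hn

theorem IsZeroSelection.tendsto (hl : 0 < l) (hz : IsZeroSelection d l z) :
    Tendsto z atTop atTop := by
  have : Tendsto (fun n : ℕ => Real.pi / (2 * l) * (n : ℝ)) atTop atTop :=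
    (tendsto_natCast_atTop_atTop (R := ℝ)).const_mul_atTop (by positivity)
  refine tendsto_atTop_mono' _ ?_ this
  filter_upwards [eventually_ge_atTop 1] with n hn
  have := hz.le hl hn
  rwa [mul_div_right_comm] at this

/-- The phase `θ = zₙl - πn` is `O(1/n)`: once `dz ≥ 2`, the zero equation gives
`|sin θ| ≤ 2 / (dz)`, and `|θ| ≤ (π/2) |sin θ|` on `[-π/2, π/2]`. -/
theorem IsZeroSelection.abs_phase_le (hd : 0 < d) (hl : 0 < l) (hz : IsZeroSelection d l z) :
    ∀ᶠ n in atTop, |z n * l - Real.pi * n| ≤ 2 * l / d * (n : ℝ)⁻¹ := by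
  filter_upwards [eventually_ge_atTop 1, (hz.tendsto hl).eventually_ge_atTop (2 / d)]
    with n hn hzn
  have hn0 : (0 : ℝ) < n := by exact_mod_cast hn
  have hz0 := hz.pos hl hn
  set θ := z n * l - Real.pi * n with hθ
  have h1 := hz.phase_eq hl hn
  rw [← hθ] at h1
  have hdz : 2 ≤ d * z n := by rwa [div_le_iff₀' hd] at hzn
  have h2 : |Real.sin θ| * (d * z n) ≤ 2 := by
    have h3 : |(d ^ 2 * z n ^ 2 - 1) * Real.sin θ| ≤ d * z n := by
      rw [← h1, abs_mul, abs_of_pos (mul_pos hd hz0)]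
      exact mul_le_of_le_one_right (mul_pos hd hz0).le (Real.abs_cos_le_one _)
    have h4 : (d * z n) ^ 2 / 2 ≤ d ^ 2 * z n ^ 2 - 1 := by nlinarith
    rw [abs_mul, abs_of_nonneg (le_trans (by positivity) h4)] at h3
    have h5 := (mul_le_mul_of_nonneg_right h4 (abs_nonneg (Real.sin θ))).trans h3
    have h6 : 0 < d * z n := mul_pos hd hz0
    by_contra! hcon
    nlinarith [mul_lt_mul_of_pos_left hcon h6]
  have h3 := Real.mul_abs_le_abs_sin (hz.abs_phase_lt hl hn).le
  rw [← hθ] at h3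
  have h4 : |Real.sin θ| * (d * (Real.pi * n / (2 * l))) ≤ 2 :=
    le_trans (by gcongr; exact hz.le hl hn) h2
  have h5 : 2 / Real.pi * |θ| * (d * (Real.pi * n / (2 * l))) ≤ 2 :=
    le_trans (by gcongr) h4
  have e : 2 / Real.pi * |θ| * (d * (Real.pi * n / (2 * l))) = |θ| * (d * n / l) := by
    have := Real.pi_ne_zero
    field_simp
  rw [e] at h5
  have : 2 * l / d * (n : ℝ)⁻¹ = 2 / (d * n / l) := by field_simp
  rw [this, le_div_iff₀ (by positivity)]
  exact h5

theorem IsZeroSelection.isBigO_sub (hd : 0 < d) (hl : 0 < l) (hz : IsZeroSelection d l z) :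
    (fun n : ℕ => z n - Real.pi * n / l) =O[atTop] fun n : ℕ => (n : ℝ)⁻¹ := by
  refine IsBigO.of_bound (2 / d) ?_
  filter_upwards [hz.abs_phase_le hd hl] with n hn
  have : z n - Real.pi * n / l = (z n * l - Real.pi * n) / l := by field_simp
  rw [this, Real.norm_eq_abs, abs_div, abs_of_pos hl, div_le_iff₀ hl,
    Real.norm_of_nonneg (by positivity)]
  refine hn.trans (le_of_eq ?_)
  ring

/-- `zₙ sin zₙl = (-1)ⁿ / d + O(1/n)`: with `θ` the phase, the zero equation reads
`dz sin θ - 1 = (cos θ - 1) + sin θ / (dz)`, where both terms are at most `|θ|`. -/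
theorem IsZeroSelection.memℓp_mul_sin (hd : 0 < d) (hl : 0 < l) (hz : IsZeroSelection d l z) :
    Memℓp (fun n => (z n * Real.sin (z n * l) : ℂ) - (-1) ^ n * (1 / d)) 2 := by
  refine memℓp_two_of_isBigO memℓp_two_inv (IsBigO.of_bound (2 / d * (2 * l / d)) ?_)
  filter_upwards [eventually_ge_atTop 1, (hz.tendsto hl).eventually_ge_atTop (1 / d),
    hz.abs_phase_le hd hl] with n hn hzn hle
  have hz0 := hz.pos hl hn
  have h1 := hz.phase_eq hl hn
  have hlt := hz.abs_phase_lt hl hn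
  have hs : Real.sin (z n * l) = (-1) ^ n * Real.sin (z n * l - Real.pi * n) := by
    rw [mul_comm Real.pi, Real.sin_sub_nat_mul_pi, ← mul_assoc, ← mul_pow]
    simp
  set θ := z n * l - Real.pi * n with hθ
  have hdz : 1 ≤ d * z n := by rwa [div_le_iff₀' hd] at hzn
  have e : (z n * Real.sin (z n * l) : ℂ) - (-1) ^ n * (1 / d)
      = (-1) ^ n * ((z n * Real.sin θ - 1 / d : ℝ) : ℂ) := by
    rw [hs]; push_cast; ring
  have e2 : z n * Real.sin θ - 1 / d = ((Real.cos θ - 1) + Real.sin θ / (d * z n)) / d := by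
    field_simp
    linear_combination -h1
  have b1 : |Real.cos θ - 1| ≤ |θ| := by
    have h3 := Real.one_sub_sq_div_two_le_cos (x := θ)
    have h4 := Real.cos_le_one θ
    rw [abs_of_nonpos (by linarith)]
    nlinarith [sq_abs θ, abs_nonneg θ, Real.pi_le_four]
  have b2 : |Real.sin θ / (d * z n)| ≤ |θ| := by
    rw [abs_div, abs_of_pos (mul_pos hd hz0)]
    exact (div_le_self (abs_nonneg _) hdz).trans (Real.abs_sin_le_abs)
  rw [e, norm_mul, norm_pow, norm_neg, norm_one, one_pow, one_mul, Complex.norm_real,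
    Real.norm_eq_abs, e2, abs_div, abs_of_pos hd, norm_inv, Complex.norm_natCast]
  calc _ ≤ (|θ| + |θ|) / d := by
        gcongr
        exact (abs_add_le _ _).trans (add_le_add b1 b2)
    _ = 2 / d * |θ| := by ring
    _ ≤ 2 / d * (2 * l / d * (n : ℝ)⁻¹) := by gcongr
    _ = _ := by ring

end Zeros

/-! ### Folding `W` at the midpoint of `(0, 2l)` -/

theorem memLp_fold_left {l : ℝ} {W : ℝ → ℂ}
    (hW : MemLp W 2 (volume.restrict (Ioo 0 (2 * l)))) (hl : 0 < l) :
    MemLp (fun x => W (l - x)) 2 (volume.restrict (Ioo 0 l)) := by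
  have h1 : MemLp W 2 (volume.restrict (Ioo 0 l)) :=
    hW.mono_measure (Measure.restrict_mono_set _ (Ioo_subset_Ioo_right (by linarith)))
  refine h1.comp_measurePreserving (f := fun x : ℝ => l - x) ?_
  have := (Measure.measurePreserving_sub_left volume l).restrict_preimage
    (measurableSet_Ioo (a := 0) (b := l))
  simpa using this

theorem memLp_fold_right {l : ℝ} {W : ℝ → ℂ}
    (hW : MemLp W 2 (volume.restrict (Ioo 0 (2 * l)))) (hl : 0 < l) :
    MemLp (fun x => W (l + x)) 2 (volume.restrict (Ioo 0 l)) := by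
  have h1 : MemLp W 2 (volume.restrict (Ioo l (2 * l))) :=
    hW.mono_measure (Measure.restrict_mono_set _ (Ioo_subset_Ioo_left hl.le))
  refine h1.comp_measurePreserving (f := fun x : ℝ => l + x) ?_
  have := (measurePreserving_add_left volume l).restrict_preimage
    (measurableSet_Ioo (a := l) (b := 2 * l))
  have e : (fun x => l + x) ⁻¹' Ioo l (2 * l) = Ioo 0 l := by
    ext x
    simp only [mem_preimage, mem_Ioo]
    constructor <;> rintro ⟨h, h'⟩ <;> constructor <;> linarith
  rwa [e] at this

theorem integral_mul_sin_fold {l : ℝ} (hl : 0 < l) {W : ℝ → ℂ}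
    (hW : MemLp W 2 (volume.restrict (Ioo 0 (2 * l)))) (z : ℝ) :
    ∫ t in (0 : ℝ)..(2 * l), W t * (Real.sin (z * t) : ℂ)
      = Real.sin (z * l) * cosT l (fun x => W (l - x) + W (l + x)) z
        - Real.cos (z * l) * sinT l (fun x => W (l - x) - W (l + x)) z := by
  have hWi := intervalIntegrable_of_memLp (by linarith) hW
  have hWs : IntervalIntegrable (fun t => W t * (Real.sin (z * t) : ℂ)) volume 0 (2 * l) :=
    intervalIntegrable_mul_sin hWi z
  have iL := intervalIntegrable_of_memLp hl.le (memLp_fold_left hW hl)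
  have iR := intervalIntegrable_of_memLp hl.le (memLp_fold_right hW hl)
  have j1 : IntervalIntegrable (fun x => W (l - x) * (Real.sin (z * (l - x)) : ℂ)) volume 0 l :=
    iL.mul_continuousOn (by fun_prop)
  have j2 : IntervalIntegrable (fun x => W (l + x) * (Real.sin (z * (l + x)) : ℂ)) volume 0 l :=
    iR.mul_continuousOn (by fun_prop)
  have e1 := intervalIntegral.integral_comp_sub_left (a := 0) (b := l)
    (fun t => W t * (Real.sin (z * t) : ℂ)) l
  have e2 := intervalIntegral.integral_comp_add_left (a := 0) (b := l)
    (fun t => W t * (Real.sin (z * t) : ℂ)) l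
  rw [sub_self, sub_zero] at e1
  rw [add_zero, ← two_mul] at e2
  rw [← intervalIntegral.integral_add_adjacent_intervals (b := l)
    (hWs.mono_set (by
      rw [uIcc_of_le hl.le, uIcc_of_le (by linarith)]
      exact Icc_subset_Icc_right (by linarith)))
    (hWs.mono_set (by
      rw [uIcc_of_le (by linarith), uIcc_of_le (by linarith)]
      exact Icc_subset_Icc_left hl.le)), ← e1, ← e2,
    ← intervalIntegral.integral_add j1 j2, cosT, sinT, ← intervalIntegral.integral_const_mul,
    ← intervalIntegral.integral_const_mul,
    ← intervalIntegral.integral_sub ((intervalIntegrable_mul_cos (iL.add iR) z).const_mul _)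
      ((intervalIntegrable_mul_sin (iL.sub iR) z).const_mul _)]
  refine intervalIntegral.integral_congr fun x _ => ?_
  simp only [mul_sub, mul_add, Real.sin_sub, Real.sin_add]
  push_cast
  ring

/-- The representation of `Δ` at a positive frequency, in terms of the sum and the difference of
the two halves of `W`. -/
theorem HasRepresentation.eq_fold {d l : ℝ} (hl : 0 < l) {u C₀ : ℂ} {W : ℝ → ℂ} {Δ : ℂ → ℂ}
    (hW : MemLp W 2 (volume.restrict (Ioo 0 (2 * l)))) (hΔ : HasRepresentation d l u C₀ W Δ)
    {z : ℝ} (hz : z ≠ 0) :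
    Δ ((z : ℂ) ^ 2) = (d : ℂ) ^ 2 * z * Real.sin (z * l) * Real.cos (z * l)
      - d * (1 - 2 * Real.sin (z * l) ^ 2) + (d : ℂ) ^ 2 * u * (Real.sin (z * l) / z)
      + 2 * C₀ * (Real.sin (z * l) * Real.cos (z * l) / z)
      + (Real.sin (z * l) * cosT l (fun x => W (l - x) + W (l + x)) z
        - Real.cos (z * l) * sinT l (fun x => W (l - x) - W (l + x)) z) / (2 * z) := by
  have hzc : (z : ℂ) ≠ 0 := by exact_mod_cast hz
  have hint : ∫ t in (0 : ℝ)..(2 * l), W t * (Complex.sin (z * t) / (2 * z))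
      = (∫ t in (0 : ℝ)..(2 * l), W t * (Real.sin (z * t) : ℂ)) / (2 * z) := by
    rw [← intervalIntegral.integral_div]
    refine intervalIntegral.integral_congr fun t _ => ?_
    push_cast
    ring
  have hcos : Complex.cos (2 * (z * l)) = 1 - 2 * Complex.sin (z * l) ^ 2 := by
    rw [Complex.cos_two_mul, ← Complex.sin_sq_add_cos_sq (z * l : ℂ)]
    ring
  rw [hΔ z hzc, hint, integral_mul_sin_fold hl hW, mul_assoc 2 (z : ℂ) (l : ℂ),
    Complex.sin_two_mul, hcos]
  push_cast
  ring

/-! ### Reflection of Sobolev functions -/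

theorem IsW12WithDeriv.comp_sub_left {l : ℝ} (hl : 0 < l) {f f' : ℝ → ℂ}
    (hf : IsW12WithDeriv l f f') :
    IsW12WithDeriv l (fun x => f (l - x)) (fun x => -f' (l - x)) := by
  have hi := intervalIntegrable_of_memLp hl.le hf.1
  constructor
  · refine (hf.1.comp_measurePreserving (f := fun x : ℝ => l - x) ?_).neg
    have := (Measure.measurePreserving_sub_left volume l).restrict_preimage
      (measurableSet_Ioo (a := 0) (b := l))
    simpa using this
  · intro x hx
    have hx' : l - x ∈ Icc 0 l := ⟨by linarith [hx.2], by linarith [hx.1]⟩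
    have h0 : l - 0 ∈ Icc 0 l := ⟨by linarith, by linarith⟩
    beta_reduce
    rw [hf.2 _ hx', hf.2 _ h0, intervalIntegral.integral_neg,
      intervalIntegral.integral_comp_sub_left (fun t => f' t) l, sub_zero,
      ← intervalIntegral.integral_interval_sub_left (a := 0) (b := l) (c := l - x) hi
        (hi.mono_set (by
          rw [uIcc_of_le hx'.1, uIcc_of_le hl.le]
          exact Icc_subset_Icc_right hx'.2))]
    ring

theorem IsW12WithDeriv.neg {l : ℝ} {f f' : ℝ → ℂ} (hf : IsW12WithDeriv l f f') :
    IsW12WithDeriv l (fun x => -f x) (fun x => -f' x) := by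
  refine ⟨hf.1.neg, fun x hx => ?_⟩
  beta_reduce
  rw [intervalIntegral.integral_neg, hf.2 x hx]
  ring

theorem isW12WithDeriv_G₁ {l : ℝ} (hl : 0 ≤ l) {g g' : ℝ → ℂ} (hg : IsW12WithDeriv l g g') :
    IsW12WithDeriv l (G₁ l g) (fun x => -g x) := by
  have hgm := hg.memLp hl
  have hi := intervalIntegrable_of_memLp hl hgm
  refine ⟨hgm.neg, fun x hx => ?_⟩
  rw [G₁, G₁, intervalIntegral.integral_neg, ← intervalIntegral.integral_interval_sub_left hi
    (hi.mono_set (by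
      rw [uIcc_of_le hx.1, uIcc_of_le hl]
      exact Icc_subset_Icc_right hx.2))]
  ring

theorem cosT_const {l : ℝ} (a : ℂ) {z : ℝ} (hz : z ≠ 0) :
    cosT l (fun _ => a) z = a * Real.sin (z * l) / z := by
  rw [cosT, intervalIntegral.integral_const_mul, intervalIntegral.integral_ofReal,
    intervalIntegral.integral_comp_mul_left (fun x => Real.cos x) hz, integral_cos]
  simp
  ring

theorem cosT_const_mul {l : ℝ} (a : ℂ) (f : ℝ → ℂ) (z : ℝ) :
    cosT l (fun x => a * f x) z = a * cosT l f z := by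
  rw [cosT, cosT, ← intervalIntegral.integral_const_mul]
  simp only [mul_assoc]

theorem sinT_const_mul {l : ℝ} (a : ℂ) (f : ℝ → ℂ) (z : ℝ) :
    sinT l (fun x => a * f x) z = a * sinT l f z := by
  rw [sinT, sinT, ← intervalIntegral.integral_const_mul]
  simp only [mul_assoc]

/-- The function `G₂(l - x)`, as the required form of `W` determines it: adding the two formulas for
`W(l - x)` and `W(l + x)` eliminates the terms `± d g(x)`. Here `c` stands for `g(l)`. -/
def reflectedG₂ (d l : ℝ) (c : ℂ) (W g g' : ℝ → ℂ) (x : ℝ) : ℂ :=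
  (d : ℂ) ^ 2 * g' x - d * c - G₁ l g x - 1 / 2 * (W (l - x) + W (l + x))

theorem memLp_reflectedG₂ {d l : ℝ} (hl : 0 < l) {c : ℂ} {W g g' : ℝ → ℂ}
    (hW : MemLp W 2 (volume.restrict (Ioo 0 (2 * l)))) (hg : IsW12WithDeriv l g g') :
    MemLp (reflectedG₂ d l c W g g') 2 (volume.restrict (Ioo 0 l)) :=
  (((hg.1.const_mul _).sub (memLp_const _)).sub ((isW12WithDeriv_G₁ hl.le hg).memLp hl.le)).sub
    (((memLp_fold_left hW hl).add (memLp_fold_right hW hl)).const_mul _)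

/-- The cosine transform of `reflectedG₂`, with `g'` and `G₁` integrated by parts. -/
theorem cosT_reflectedG₂ {d l : ℝ} (hl : 0 < l) {c : ℂ} {W g g' : ℝ → ℂ}
    (hW : MemLp W 2 (volume.restrict (Ioo 0 (2 * l)))) (hg : IsW12WithDeriv l g g')
    {z : ℝ} (hz : z ≠ 0) :
    cosT l (reflectedG₂ d l c W g g') z
      = (d : ℂ) ^ 2 * (g l * Real.cos (z * l) - g 0 + z * sinT l g z)
        - d * c * Real.sin (z * l) / z - sinT l g z / z
        - 1 / 2 * cosT l (fun x => W (l - x) + W (l + x)) z := by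
  have hzc : (z : ℂ) ≠ 0 := by exact_mod_cast hz
  have hG := isW12WithDeriv_G₁ hl.le hg
  have i1 := intervalIntegrable_of_memLp hl.le (hg.1.const_mul ((d : ℂ) ^ 2))
  have i2 : IntervalIntegrable (fun _ => (d : ℂ) * c) volume 0 l := intervalIntegrable_const
  have i3 := intervalIntegrable_of_memLp hl.le (hG.memLp hl.le)
  have i4 := intervalIntegrable_of_memLp hl.le
    (((memLp_fold_left hW hl).add (memLp_fold_right hW hl)).const_mul (1 / 2 : ℂ))
  have hGs : cosT l (G₁ l g) z = sinT l g z / z := by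
    have h1 := hG.sinT_deriv hl.le z
    have h2 : G₁ l g l = 0 := by simp [G₁]
    have h3 : sinT l (fun x => -g x) z = -sinT l g z := by
      simpa using sinT_const_mul (l := l) (-1) g z
    rw [h2, h3] at h1
    rw [eq_div_iff hzc]
    linear_combination h1
  have e : cosT l (fun x => (d : ℂ) ^ 2 * g' x - d * c - G₁ l g x) z
      = cosT l (fun x => (d : ℂ) ^ 2 * g' x) z - cosT l (fun _ => d * c) z - cosT l (G₁ l g) z :=
    (cosT_sub (i1.sub i2) i3 z).trans (congrArg (· - _) (cosT_sub i1 i2 z))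
  rw [cosT_const_mul, cosT_const _ hz, hGs, hg.cosT_deriv hl.le] at e
  rw [← e, ← cosT_const_mul]
  exact cosT_sub ((i1.sub i2).sub i3) i4 z

/-- At a zero `z` of `c₂(z²)` the terms of `Δ` containing the sine transform `s` of `g` cancel; the
zero equation and the choice of `c` reduce the remaining explicit terms to multiples of `S² / z²`.
Here `S = sin zl`, `C = cos zl`, `p` is the cosine transform of `W(l - x) + W(l + x)`, `Γ` that of
`G₂(l - x)`, and `D` is the value of `Δ`. -/
theorem Δ_eq_of_zero {d z S C : ℝ} (hd : d ≠ 0) (hz : z ≠ 0)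
    (h0 : d * z * C = (d ^ 2 * z ^ 2 - 1) * S) (hSC : S ^ 2 + C ^ 2 = 1) {u C₀ c s p Γ D : ℂ}
    (hc : c = -(2 * (C₀ + 1)) / (d : ℂ) ^ 2)
    (hD : D = (d : ℂ) ^ 2 * z * S * C - d * (1 - 2 * S ^ 2) + (d : ℂ) ^ 2 * u * (S / z)
      + 2 * C₀ * (S * C / z) + (S * p - C * (2 * d * s)) / (2 * z))
    (hΓ : Γ = (d : ℂ) ^ 2 * (c * C - u + z * s) - d * c * S / z - s / z - 1 / 2 * p) :
    D = S ^ 2 / (d * z ^ 2) - d * c * S ^ 2 / z ^ 2 - S / z * Γ := by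
  have hd' : (d : ℂ) ≠ 0 := by exact_mod_cast hd
  have hz' : (z : ℂ) ≠ 0 := by exact_mod_cast hz
  have h0' : (d : ℂ) * z * C = (d ^ 2 * z ^ 2 - 1) * S := by exact_mod_cast h0
  have hSC' : (S : ℂ) ^ 2 + C ^ 2 = 1 := by exact_mod_cast hSC
  have hC₀ : C₀ = -(d : ℂ) ^ 2 * c / 2 - 1 := by
    rw [hc]; field_simp; ring
  have hp : p = 2 * ((d : ℂ) ^ 2 * (c * C - u + z * s) - d * c * S / z - s / z - Γ) := by
    rw [hΓ]; ring
  rw [hD, hC₀, hp]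
  have e1 : (C : ℂ) = (d ^ 2 * z ^ 2 - 1) * S / (d * z) := by
    rw [eq_div_iff (mul_ne_zero hd' hz')]
    linear_combination h0'
  have hS : (1 : ℂ) - 2 * S ^ 2 = C ^ 2 - S ^ 2 := by linear_combination -hSC'
  rw [hS, e1]
  field_simp
  ring

/-! ### Recovering `g` and `G₂` -/

theorem memℓp_neg_one_pow_mul {a : ℕ → ℂ} (ha : Memℓp a 2) :
    Memℓp (fun n => (-1) ^ n * a n) 2 :=
  memℓp_two_bdd_mul ha (IsBigO.of_bound 1 (.of_forall fun n => by simp))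

/-- The values of `Δ` at `(πn/l)²` give the sine coefficients of `W(l - x) - W(l + x)`, which is
therefore `2dg` with `g` in `W¹₂`. -/
theorem exists_g {d l : ℝ} (hd : 0 < d) (hl : 0 < l) {u C₀ : ℂ} {W : ℝ → ℂ}
    (hW : MemLp W 2 (volume.restrict (Ioo 0 (2 * l)))) {Δ : ℂ → ℂ}
    (hΔ : HasRepresentation d l u C₀ W Δ) {c : ℂ} {κ : ℕ → ℂ} (hκ : Memℓp κ 2)
    (hcon : ∀ n : ℕ, 1 ≤ n →
      Δ (((Real.pi * n / l : ℝ) : ℂ) ^ 2) =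
        -d + d * ((l / (Real.pi * n) : ℝ) : ℂ) ^ 2 * (c - (-1) ^ n * u + κ n)) :
    ∃ g g' : ℝ → ℂ, IsW12WithDeriv l g g' ∧ g 0 = u ∧ g l = c ∧
      ∀ᵐ x : ℝ, x ∈ Ioo 0 l → W (l - x) - W (l + x) = 2 * d * g x := by
  have hd' : (d : ℂ) ≠ 0 := by exact_mod_cast hd.ne'
  have hl' : (l : ℂ) ≠ 0 := by exact_mod_cast hl.ne'
  have hM := (memLp_fold_left hW hl).sub (memLp_fold_right hW hl)
  obtain ⟨g, g', hg, hg0, hgl, h⟩ := exists_W12_of_sinT hl (hM.const_mul (1 / (2 * d) : ℂ)) u c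
    (memℓp_neg_one_pow_mul hκ).neg fun n hn => by
      have hn0 : (0 : ℝ) < n := by exact_mod_cast hn
      have hn' : (n : ℂ) ≠ 0 := by exact_mod_cast hn0.ne'
      have hπ : (Real.pi : ℂ) ≠ 0 := by exact_mod_cast Real.pi_ne_zero
      have hν : Real.pi * n / l ≠ 0 := by positivity
      have h1 := hcon n hn
      rw [hΔ.eq_fold hl hW hν, sin_pi_nat_div hl.ne', cos_pi_nat_div hl.ne'] at h1
      have hsq : ((-1 : ℂ) ^ n) ^ 2 = 1 := by rw [← pow_mul, mul_comm, pow_mul]; simp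
      rw [sinT_const_mul]
      simp only [Pi.neg_apply]
      change _ * (_ * sinT l (fun x => W (l - x) - W (l + x)) _) = _
      set s := sinT l (fun x => W (l - x) - W (l + x)) (Real.pi * n / l)
      push_cast at h1 ⊢
      generalize (-1 : ℂ) ^ n = ε at h1 hsq ⊢
      field_simp at h1 ⊢
      refine mul_left_cancel₀ (pow_ne_zero 2 hl') ?_
      linear_combination -ε * h1 - (Real.pi * n * s * l ^ 2 - 2 * d * l ^ 3 * u) * hsq
  refine ⟨g, g', hg, hg0, hgl, ?_⟩
  filter_upwards [h] with x hx hx0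
  rw [← hx hx0]
  simp only [Pi.sub_apply]
  field_simp

/-- The values of `Δ` at the zeros of `c₂` give the asymptotics of the cosine transform of
`reflectedG₂` there, which is therefore a `W²₂` function up to a null set. -/
theorem exists_reflectedG₂ {d l : ℝ} (hd : 0 < d) (hl : 0 < l) {z : ℕ → ℝ}
    (hz : IsZeroSelection d l z) {u C₀ : ℂ} {W : ℝ → ℂ}
    (hW : MemLp W 2 (volume.restrict (Ioo 0 (2 * l)))) {Δ : ℂ → ℂ}
    (hΔ : HasRepresentation d l u C₀ W Δ) {c : ℂ} (hc : c = -(2 * (C₀ + 1)) / (d : ℂ) ^ 2)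
    {h₁ h₂ : ℂ} {η : ℕ → ℂ} (hη : Memℓp η 2)
    (hcon : ∀ n : ℕ, 1 ≤ n →
      Δ ((z n : ℂ) ^ 2) =
        ((Real.sin (z n * l) / z n ^ 3 : ℝ) : ℂ) * (h₂ - (-1) ^ n * h₁ + η n))
    {g g' : ℝ → ℂ} (hg : IsW12WithDeriv l g g') (hg0 : g 0 = u) (hgl : g l = c)
    (hWg : ∀ᵐ x : ℝ, x ∈ Ioo 0 l → W (l - x) - W (l + x) = 2 * d * g x) :
    ∃ F F' F'' : ℝ → ℂ, IsW12WithDeriv l F F' ∧ IsW12WithDeriv l F' F'' ∧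
      ∀ᵐ x : ℝ, x ∈ Ioo 0 l → reflectedG₂ d l c W g g' x = F x := by
  have hd' : (d : ℂ) ≠ 0 := by exact_mod_cast hd.ne'
  have hs := hz.memℓp_mul_sin hd hl
  refine exists_W22_of_cosT hl (memLp_reflectedG₂ hl hW hg) (hz.isBigO_sub hd hl) hs
    (a := -h₂) (b := h₁ + 1 / d * (1 / d - d * c)) ?_
  refine memℓp_two_of_isBigO ((hs.const_smul (1 / d - d * c)).sub hη) (EventuallyEq.isBigO ?_)
  filter_upwards [eventually_ge_atTop 1] with n hn
  have hz0 := (hz.pos hl hn).ne'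
  have hzc : (z n : ℂ) ≠ 0 := by exact_mod_cast hz0
  have hS : (Real.sin (z n * l) : ℂ) ≠ 0 := by exact_mod_cast hz.sin_ne_zero hd hl hn
  have h1 := hΔ.eq_fold hl hW hz0
  rw [sinT_congr_ae hl.le hWg, sinT_const_mul] at h1
  have hΓ := cosT_reflectedG₂ (d := d) (c := c) hl hW hg hz0
  rw [hg0, hgl] at hΓ
  have key := Δ_eq_of_zero hd.ne' hz0 (hz.cos_eq hl hn) (Real.sin_sq_add_cos_sq _) hc h1 hΓ
  rw [hcon n hn] at key
  simp only [Pi.sub_apply, Pi.smul_apply, smul_eq_mul]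
  generalize cosT l (reflectedG₂ d l c W g g') (z n) = Γ at key ⊢
  push_cast at key hS ⊢
  generalize Complex.sin (z n * l) = S at key hS ⊢
  field_simp at key ⊢
  linear_combination d * key

/-- An almost-everywhere statement on `(0, l)` transported by `t ↦ l - t`. -/
theorem ae_comp_sub_left {l : ℝ} {p : ℝ → Prop} (h : ∀ᵐ x : ℝ, x ∈ Ioo 0 l → p x) :
    ∀ᵐ t : ℝ, t ∈ Ioo 0 l → p (l - t) := by
  filter_upwards [(Measure.measurePreserving_sub_left volume l).quasiMeasurePreserving.ae h]
    with t ht ht0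
  exact ht ⟨by linarith [ht0.2], by linarith [ht0.1]⟩

/-- An almost-everywhere statement on `(0, l)` transported by `t ↦ t - l`. -/
theorem ae_comp_sub_right {l : ℝ} {p : ℝ → Prop} (h : ∀ᵐ x : ℝ, x ∈ Ioo 0 l → p x) :
    ∀ᵐ t : ℝ, t ∈ Ioo l (2 * l) → p (t - l) := by
  filter_upwards [(measurePreserving_sub_right volume l).quasiMeasurePreserving.ae h]
    with t ht ht0
  exact ht ⟨by linarith [ht0.1], by linarith [ht0.2]⟩

/-- The form of `W` follows from `g = (W(l - x) - W(l + x)) / (2d)` and the definition of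
`reflectedG₂`, through `W(l ∓ x) = (P(x) ± M(x)) / 2`. -/
theorem hasStructuredForm_of_reflectedG₂ {d l : ℝ} {c : ℂ} {W g g' F : ℝ → ℂ} (hgl : g l = c)
    (hWg : ∀ᵐ x : ℝ, x ∈ Ioo 0 l → W (l - x) - W (l + x) = 2 * d * g x)
    (hF : ∀ᵐ x : ℝ, x ∈ Ioo 0 l → reflectedG₂ d l c W g g' x = F x) :
    HasStructuredForm d l W g g' (fun t => F (l - t)) := by
  constructor
  · filter_upwards [ae_comp_sub_left hWg, ae_comp_sub_left hF, Measure.ae_ne volume 0]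
      with t h1 h2 h0 ht
    have ht' : t ∈ Ioo 0 l := ⟨lt_of_le_of_ne ht.1 h0.symm, ht.2⟩
    have h1' := h1 ht'
    rw [← h2 ht', reflectedG₂, hgl]
    rw [show l - (l - t) = t by ring] at h1' ⊢
    linear_combination h1' / 2
  · filter_upwards [ae_comp_sub_right hWg, ae_comp_sub_right hF, Measure.ae_ne volume l,
      Measure.ae_ne volume (2 * l)] with t h1 h2 h0 h0' ht
    have ht' : t ∈ Ioo l (2 * l) := ⟨lt_of_le_of_ne ht.1 h0.symm, lt_of_le_of_ne ht.2 h0'⟩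
    have h1' := h1 ht'
    rw [show l - (2 * l - t) = t - l by ring, ← h2 ht', reflectedG₂, hgl]
    rw [show l + (t - l) = t by ring] at h1' ⊢
    linear_combination -h1' / 2

end FrozenArg
end

theorem theorem4 (d l : ℝ) (hd : 0 < d) (hl : 0 < l)
    (z : ℕ → ℝ) (hz : FrozenArg.IsZeroSelection d l z)
    (u C₀ : ℂ) (W : ℝ → ℂ) (hW : MemLp W 2 (volume.restrict (Ioo 0 (2 * l))))
    (Δ : ℂ → ℂ) (hΔ : FrozenArg.HasRepresentation d l u C₀ W Δ)
    (c : ℂ) (hc : c = -(2 * (C₀ + 1)) / (d : ℂ) ^ 2)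
    (κ : ℕ → ℂ) (hκ : Memℓp κ 2)
    (hcon1 : ∀ n : ℕ, 1 ≤ n →
      Δ (((Real.pi * n / l : ℝ) : ℂ) ^ 2) =
        -d + d * ((l / (Real.pi * n) : ℝ) : ℂ) ^ 2 * (c - (-1) ^ n * u + κ n))
    (h₁ h₂ : ℂ) (η : ℕ → ℂ) (hη : Memℓp η 2)
    (hcon2 : ∀ n : ℕ, 1 ≤ n →
      Δ ((z n : ℂ) ^ 2) =
        ((Real.sin (z n * l) / z n ^ 3 : ℝ) : ℂ) * (h₂ - (-1) ^ n * h₁ + η n)) :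
    ∃ g g' G₂ : ℝ → ℂ,
      FrozenArg.IsW12WithDeriv l g g' ∧
      FrozenArg.MemW22 l G₂ ∧
      g 0 = u ∧ g l = c ∧
      FrozenArg.HasStructuredForm d l W g g' G₂ ∧
      (∀ᵐ t : ℝ, t ∈ Icc 0 l → g t = (W (l - t) - W (l + t)) / (2 * d)) := by
  obtain ⟨g, g', hg, hg0, hgl, hWg⟩ := FrozenArg.exists_g hd hl hW hΔ hκ hcon1
  obtain ⟨F, F', F'', hF, hF', hWF⟩ := FrozenArg.exists_reflectedG₂ hd hl hz hW hΔ hc hη hcon2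
    hg hg0 hgl hWg
  refine ⟨g, g', fun t => F (l - t), hg,
    ⟨fun t => -F' (l - t), fun t => F'' (l - t), hF.comp_sub_left hl, ?_⟩, hg0, hgl,
    FrozenArg.hasStructuredForm_of_reflectedG₂ hgl hWg hWF, ?_⟩
  · simpa using (hF'.comp_sub_left hl).neg
  · have hd' : (d : ℂ) ≠ 0 := by exact_mod_cast hd.ne'
    filter_upwards [hWg, Measure.ae_ne volume 0, Measure.ae_ne volume l] with t ht h0 hl0 htI
    rw [ht ⟨lt_of_le_of_ne htI.1 h0.symm, lt_of_le_of_ne htI.2 hl0⟩]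
    field_simp
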